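/- **Model.** Let $\tau$ be the number of classes and $\mathcal Y=[\tau]\cup\{\text{null}\}$. Objects $1,\dots,\ell$ have labels $T_1,\dots,T_\ell$ drawn i.i.d. from an unknown prior $P_T$ on $[\tau]$; the correct clustering $P^*(T^\ell)$ puts two objects together iff their labels agree. For a label sequence $t^\ell$ let $\tilde\imath$ be the largest $j<i$ with $t_j=t_i$ (if it exists) and $\mathcal N_i$ the set consisting of $i-1$ (if $i>1$) and $\tilde\imath$ (if it exists). A long-term worker with Markov memory answers a sequence of objects with labels $t^\ell$ by $Y^\ell$ with law $\prod_i Q_i(y_i\mid y_{\mathcal N_i},t_i)$. Workers are drawn independently from a pool, so that the response vectors of different workers are i.i.d. with the mean law $\bar Q(\cdot\mid t^\ell)=\mathbb E_w\,Q^{(w)}(\cdot\mid t^\ell)$, which is assumed to have the same Markov-memory form. Write $I$ for mutual information under $\bar Q(\cdot\mid t^\ell)$. The memory quality of $t^\ell$ is $$\theta_m(t^\ell)=\tfrac12\Big(\min_{i}I(Y_i;Y_{i-1},Y_{\tilde\imath})-\max_{i}\ \max_{j<i,\ j\ne\tilde\imath}I(Y_i;Y_{i-1},Y_j)\Big),$$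 where $i$ runs over the indices for which $\tilde\imath$ exists and $\tilde\imath\neq i-1$ (and $\theta_m(t^\ell)=+\infty$ if there are none). The memory quality $\theta_m$ of the pool is the minimum of $\theta_m(t^\ell)$ over all $t^\ell$ with $\prod_iP_T(t_i)>0$. **Algorithm.** Fix $c_1>0$, $0<\alpha<1/2$ and put $\gamma_n=c_1n^{-\alpha}$. $\Phi_{\rm info}(I)$: for $i=\ell,\dots,1$, open a new cluster containing $i$ if $i$ is not yet assigned; then, if $i>1$, let $\eta_i$ be the largest $j<i$ with $I(Y_i;Y_{i-1},Y_j)\ge\max_{k<i}I(Y_i;Y_{i-1},Y_k)-\gamma_n$, and if $\eta_i$ is not yet assigned put it into the cluster of $i$. $\Phi_{\rm mem}$: in each of $k$ independent rounds, put the objects in a uniformly random order, collect the response vectors of $n$ new workers to that sequence, compute the plug-in (empirical) mutual informations and apply $\Phi_{\rm info}$ to get a partition of the objects; output that one of the $k$ partitions which is finer than all of them (if there is none, this counts as an error). $P_e(\Phi_{\rm mem})$ is the probability that the output is not $P^*(T^\ell)$. **Theorem.** (a) Let $0<\beta<1$ with $2\alpha+\beta<1$ or $4\alpha<1$, and let $\kappa\in\mathbb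 N$. There is a constant $C>0$ depending only on $\tau,\alpha,\beta,c_1,\kappa$ such that the following holds for every $\ell>\tau^2$, every pool, every prior $P_T$, every $\epsilon>0$ and every real $\theta$ with $0<\theta\le\theta_m$. Put $k_0=\max\{0,\lceil -\log\epsilon/(\log\ell-2\log\tau)\rceil\}$. If $k_0\le k\le\kappa\max\{1,k_0\}$, $\log_2^2n\le n^\beta$ and $$n\ \ge\ C\max\Big\{(\log\ell-\log\epsilon)^{\frac1{1-2\alpha-\beta}},\ (\log\ell-\log\epsilon)^{\frac1{1-4\alpha}},\ \theta^{-1/\alpha}\Big\},$$ then $P_e(\Phi_{\rm mem})\le2\epsilon$. (When $\theta_m<\infty$ one may take $\theta=\theta_m$. An exponent whose denominator vanishes is read as $0$. For $\epsilon\ge\tfrac12$ the claim is trivial.) (b) For fixed $\ell>\tau^2$, every pool and every prior $P_T$ with $\theta_m>0$, $\Phi_{\rm mem}$ is asymptotically consistent when the number of rounds grows: for every sequence $k_n\to\infty$ with $k_n=O(n^d)$ for some $d$, the error probability of $\Phi_{\rm mem}$ with $k_n$ rounds of $n$ workers each tends to $0$ as $n\to\infty$. -/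

import Mathlib

open Finset Filter Topology

noncomputable section

/-- A response is one of the `τ` class labels, or the null response `none`. -/
abbrev Response (τ : ℕ) : Type := Option (Fin τ)

/-- The index `i - 1` of the object preceding `i` (only used when `i` is not the first index). -/
def prevIdx {ℓ : ℕ} (i : Fin ℓ) : Fin ℓ := ⟨i.val - 1, by omega⟩

/-- The preceding index as an optional index: there is none for the first object. -/
def prevNeighbor {ℓ : ℕ} (i : Fin ℓ) : Option (Fin ℓ) :=
  if 0 < i.val then some (prevIdx i) else none

/-- The most recent earlier index carrying the same label as `i`, if there is one. -/
def sameNeighbor {τ ℓ : ℕ} (t : Fin ℓ → Fin τ) (i : Fin ℓ) : Option (Fin ℓ) :=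
  if h : (univ.filter (fun j : Fin ℓ => j < i ∧ t j = t i)).Nonempty then
    some ((univ.filter (fun j : Fin ℓ => j < i ∧ t j = t i)).max' h)
  else none

/-- The conditional pmfs of a worker with Markov memory. `prob i a b s y` is the probability that
the worker answers `y` to the `i`-th object, of label `s`, when `a` is the answer to the preceding
object and `b` the answer to the most recent earlier object with the same label (each is `none`
when there is no such object). -/
structure MemoryKernel (τ ℓ : ℕ) where
  prob : Fin ℓ → Option (Response τ) → Option (Response τ) → Fin τ → Response τ → ℝ
  nonneg : ∀ i a b s y, 0 ≤ prob i a b s y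
  sum_eq_one : ∀ i a b s, ∑ y, prob i a b s y = 1

/-- The law of the response vector `y` of a worker with memory kernel `K` to a sequence of objects
with labels `t`. -/
def MemoryKernel.law {τ ℓ : ℕ} (K : MemoryKernel τ ℓ) (t : Fin ℓ → Fin τ)
    (y : Fin ℓ → Response τ) : ℝ :=
  ∏ i, K.prob i ((prevNeighbor i).map y) ((sameNeighbor t i).map y) (t i) (y i)

/-- A pool of long-term workers with Markov memory: a probability distribution on a set `W` of
workers, each of them with a memory kernel. -/
structure WorkerPool (τ ℓ : ℕ) (W : Type*) [MeasurableSpace W] where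
  dist : MeasureTheory.Measure W
  isProbabilityMeasure : MeasureTheory.IsProbabilityMeasure dist
  kernel : W → MemoryKernel τ ℓ
  measurable_kernel : ∀ i a b s y, Measurable (fun w => (kernel w).prob i a b s y)

/-- The law of the response vector of a worker drawn at random from the pool. -/
def WorkerPool.meanLaw {τ ℓ : ℕ} {W : Type*} [MeasurableSpace W] (p : WorkerPool τ ℓ W)
    (t : Fin ℓ → Fin τ) (y : Fin ℓ → Response τ) : ℝ :=
  ∫ w, (p.kernel w).law t y ∂p.dist

/-- The law of a random worker of the pool again has the Markov memory structure. -/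
def WorkerPool.MeanIsMarkov {τ ℓ : ℕ} {W : Type*} [MeasurableSpace W]
    (p : WorkerPool τ ℓ W) : Prop :=
  ∃ K : MemoryKernel τ ℓ, ∀ t y, p.meanLaw t y = K.law t y

open Classical in
/-- The Shannon entropy (in nats) of the random variable `f` when the pmf on `Ω` is `p`. -/
def entropy {Ω A : Type*} [Fintype Ω] [Fintype A] (p : Ω → ℝ) (f : Ω → A) : ℝ :=
  ∑ a, Real.negMulLog (∑ ω ∈ univ.filter (fun ω => f ω = a), p ω)

/-- The mutual information of the random variables `f` and `g` when the pmf on `Ω` is `p`. -/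
def mutualInfo {Ω A B : Type*} [Fintype Ω] [Fintype A] [Fintype B] (p : Ω → ℝ)
    (f : Ω → A) (g : Ω → B) : ℝ :=
  entropy p f + entropy p g - entropy p (fun ω => (f ω, g ω))

/-- `I(Y_i ; Y_{i-1}, Y_j)` when the response vector has pmf `p` (used for `j < i`). -/
def pairInfo {τ ℓ : ℕ} (p : (Fin ℓ → Response τ) → ℝ) (i j : Fin ℓ) : ℝ :=
  mutualInfo p (fun y => y i) (fun y => (y (prevIdx i), y j))

/-- The index `i` has two distinct neighbours: `m` is the most recent earlier index with the label
of `i`, and it differs from `i - 1`. -/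
def TwoNeighbors {τ ℓ : ℕ} (t : Fin ℓ → Fin τ) (i m : Fin ℓ) : Prop :=
  sameNeighbor t i = some m ∧ m ≠ prevIdx i

/-- The memory quality for one sequence of labels `t`, where `p` is the law of the response vector:
half the difference between the least information about `Y_i` in its two neighbours and the largest
information about it in `Y_{i-1}` and another earlier response. The indices `i` are those with two
distinct neighbours; the value is `⊤` when there are none. -/
def seqMemoryQuality {τ ℓ : ℕ} (p : (Fin ℓ → Response τ) → ℝ) (t : Fin ℓ → Fin τ) : EReal :=
  ((⨅ (i : Fin ℓ) (m : Fin ℓ) (_ : TwoNeighbors t i m), ((pairInfo p i m : ℝ) : EReal)) -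
    (⨆ (i : Fin ℓ) (m : Fin ℓ) (_ : TwoNeighbors t i m) (j : Fin ℓ) (_ : j < i ∧ j ≠ m),
      ((pairInfo p i j : ℝ) : EReal))) / 2

/-- The memory quality of a pool: the least one over the label sequences that occur with positive
probability when labels are drawn from the prior `PT`. -/
def WorkerPool.memoryQuality {τ ℓ : ℕ} {W : Type*} [MeasurableSpace W] (p : WorkerPool τ ℓ W)
    (PT : Fin τ → ℝ) : EReal :=
  ⨅ (t : Fin ℓ → Fin τ) (_ : ∀ i, 0 < PT (t i)), seqMemoryQuality (p.meanLaw t) t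

open Classical in
/-- The parent chosen for `i`: the largest `j < i` whose information value `I i j` is at least
`max_{k < i} I i k - γ`. There is none for the first index. -/
def parent {ℓ : ℕ} (I : Fin ℓ → Fin ℓ → ℝ) (γ : ℝ) (i : Fin ℓ) : Option (Fin ℓ) :=
  if h : (univ.filter (fun j : Fin ℓ => j < i ∧ ∀ k, k < i → I i k - γ ≤ I i j)).Nonempty then
    some ((univ.filter (fun j : Fin ℓ => j < i ∧ ∀ k, k < i → I i k - γ ≤ I i j)).max' h)
  else none

/-- State of the information clustering algorithm: the cluster number of each object (`none` if it
has not been assigned), and the number of clusters opened so far. -/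
structure InfoState (ℓ : ℕ) where
  label : Fin ℓ → Option ℕ
  count : ℕ

/-- Open a new cluster for `i` if `i` has not been assigned. -/
def InfoState.openCluster {ℓ : ℕ} (s : InfoState ℓ) (i : Fin ℓ) : InfoState ℓ :=
  if s.label i = none then ⟨Function.update s.label i (some (s.count + 1)), s.count + 1⟩ else s

/-- Put `j` into the cluster of `i` if `j` has not been assigned. -/
def InfoState.attach {ℓ : ℕ} (s : InfoState ℓ) (i j : Fin ℓ) : InfoState ℓ :=
  if s.label j = none then ⟨Function.update s.label j (s.label i), s.count⟩ else s

/-- One pass of the loop of the information clustering algorithm. -/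
def infoStep {ℓ : ℕ} (I : Fin ℓ → Fin ℓ → ℝ) (γ : ℝ) (s : InfoState ℓ) (i : Fin ℓ) :
    InfoState ℓ :=
  match parent I γ i with
  | none => s.openCluster i
  | some j => (s.openCluster i).attach i j

/-- The information clustering algorithm: it runs through the indices from the last to the first,
and returns the partition (as an equivalence relation; `≤` is "finer than") into clusters. -/
def infoPartition {ℓ : ℕ} (I : Fin ℓ → Fin ℓ → ℝ) (γ : ℝ) : Setoid (Fin ℓ) :=
  Setoid.ker
    ((List.finRange ℓ).reverse.foldl (infoStep I γ) ⟨fun _ => none, 0⟩).label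

open Classical in
/-- The empirical pmf of `n` response vectors. -/
def empiricalLaw {τ ℓ n : ℕ} (Y : Fin n → Fin ℓ → Response τ) (y : Fin ℓ → Response τ) : ℝ :=
  ((univ.filter (fun j => Y j = y)).card : ℝ) / n

/-- The partition of the objects found in one round. The objects were shown in the order `ξ` (the
object `ξ i` at position `i`), and worker `j` gave the answer `Y j i` at position `i`. The
information values are the plug-in estimates, and the partition of the positions is carried back
to the objects. -/
def roundPartition {τ ℓ n : ℕ} (γ : ℝ) (ξ : Equiv.Perm (Fin ℓ))
    (Y : Fin n → Fin ℓ → Response τ) : Setoid (Fin ℓ) :=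
  Setoid.comap ξ.symm (infoPartition (pairInfo (empiricalLaw Y)) γ)

open Classical in
/-- Clustering with memory: the finest one among the partitions of the `k` rounds, or `none`
(failure) if no partition of a round is finer than all the others. -/
def memDecoder {τ ℓ n k : ℕ} (γ : ℝ) (ξ : Fin k → Equiv.Perm (Fin ℓ))
    (Y : Fin k → Fin n → Fin ℓ → Response τ) : Option (Setoid (Fin ℓ)) :=
  if h : ∃ r, ∀ s, roundPartition γ (ξ r) (Y r) ≤ roundPartition γ (ξ s) (Y s) then
    some (roundPartition γ (ξ h.choose) (Y h.choose))
  else none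

/-- The correct clustering for the labels `t`. -/
def correctPartition {τ ℓ : ℕ} (t : Fin ℓ → Fin τ) : Setoid (Fin ℓ) := Setoid.ker t

/-- The threshold `c₁ n ^ (-α)`. -/
def threshold (c₁ α : ℝ) (n : ℕ) : ℝ := c₁ * (n : ℝ) ^ (-α)

open Classical in
/-- The error probability of clustering with memory, with `k` rounds and `n` workers in each. The
labels `t` are drawn independently from `PT`, the orders `ξ r` independently and uniformly, and the
response vectors `Y r j` independently from the law of a random worker of the pool on the labels
`t ∘ ξ r` of the objects in the order of round `r`. -/
def WorkerPool.errorProb {τ ℓ : ℕ} {W : Type*} [MeasurableSpace W] (p : WorkerPool τ ℓ W)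
    (PT : Fin τ → ℝ) (c₁ α : ℝ) (k n : ℕ) : ℝ :=
  ∑ t : Fin ℓ → Fin τ, (∏ i, PT (t i)) *
    ∑ ξ : Fin k → Equiv.Perm (Fin ℓ), (1 / (Nat.factorial ℓ : ℝ)) ^ k *
      ∑ Y : Fin k → Fin n → Fin ℓ → Response τ,
        (∏ r, ∏ j, p.meanLaw (t ∘ ξ r) (Y r j)) *
          if memDecoder (threshold c₁ α n) ξ Y = some (correctPartition t) then 0 else 1

end

/-!
Suppose that in every round all plug-in information values are within `γ / 2` of the true ones,
where `γ = threshold c₁ α n` is below the memory quality. If an index `i` has two distinct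
neighbours, the memory quality makes the most recent index with the label of `i` the only one that
passes the threshold. Otherwise the Markov property makes `I(Y_i; Y_{i-1}, Y_k)` independent of `k`
(`MemoryKernel.pairInfo_eq`), so that `i - 1` passes, and it is the largest candidate. Hence the
algorithm works with the parents of `idealParent` (`parent_eq_idealParent`).

With these parents, objects with equal labels always end in one cluster, and distinct labels are
merged only at a handover, where the last object with some label is immediately followed by the
first object with another one (`ker_le_infoPartition`, `infoPartition_eq_ker`). So the partition of
every round is coarser than the correct one or equal to it, and the finest one is correct as soon as
one round has no handover (`memDecoder_eq_some`).

For a given pair of labels, a random order has a handover with probability at most `1 / ℓ`: the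
orders with one are encoded injectively by orders that start with a given object
(`mul_card_isHandoverAt_le`). Thus all `k` rounds fail with probability at most `(τ ^ 2 / ℓ) ^ k`,
which is at most `ε` for `k ≥ k₀`.

The accuracy comes from Chernoff bounds for the frequencies of single answers, pairs and triples.
Since `x log x` has modulus of continuity `δ (1 - log δ)`, frequencies that are accurate up to
`δ = c n ^ (-α) / (1 + log n)` suffice (`exists_accuracy`), and they fail to be so with probability
of order `exp (-c² n ^ (1 - 2 α) / (4 (1 + log n) ^ 2))`. Estimating `(1 + log n) ^ 2` by a multiple
of `n ^ β` or of `n ^ (2 α)` turns this into both exponents of the sample complexity, and a union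
bound over rounds and pairs of indices concludes.
-/

/-! ### The information clustering algorithm with the ideal parents -/

/-- At position `i` the most recent label disappears for good and a new label appears: the label of
`i` has not occurred before, and the label of `i - 1` does not occur again. -/
def IsHandover {τ ℓ : ℕ} (t : Fin ℓ → Fin τ) (i : Fin ℓ) : Prop :=
  0 < i.val ∧ (∀ j < i, t j ≠ t i) ∧ ∀ k, i ≤ k → t k ≠ t (prevIdx i)

/-- The parent that `i` receives when the estimates of the information values are accurate. -/
def idealParent {τ ℓ : ℕ} (t : Fin ℓ → Fin τ) (i : Fin ℓ) : Option (Fin ℓ) :=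
  (sameNeighbor t i).or (prevNeighbor i)

theorem sameNeighbor_eq_some {τ ℓ : ℕ} {t : Fin ℓ → Fin τ} {i m : Fin ℓ} :
    sameNeighbor t i = some m ↔ m < i ∧ t m = t i ∧ ∀ j < i, t j = t i → j ≤ m := by
  unfold sameNeighbor
  split_ifs with h
  · have h1 := Finset.max'_mem _ h
    simp only [mem_filter, mem_univ, true_and] at h1
    simp only [Option.some.injEq]
    constructor
    · rintro rfl
      exact ⟨h1.1, h1.2, fun j hj hjt => Finset.le_max' _ _ (by simp [hj, hjt])⟩
    · rintro ⟨h2, h3, h4⟩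
      exact le_antisymm (h4 _ h1.1 h1.2) (Finset.le_max' _ _ (by simp [h2, h3]))
  · simp only [false_iff]
    rintro ⟨h2, h3, -⟩
    exact h ⟨m, by simp [h2, h3]⟩

theorem sameNeighbor_eq_none {τ ℓ : ℕ} {t : Fin ℓ → Fin τ} {i : Fin ℓ} :
    sameNeighbor t i = none ↔ ∀ j < i, t j ≠ t i := by
  unfold sameNeighbor
  split_ifs with h
  · obtain ⟨j, hj⟩ := h
    simp only [mem_filter, mem_univ, true_and] at hj
    simp only [ne_eq, false_iff, not_forall, not_not]
    exact ⟨j, hj.1, hj.2⟩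
  · simp only [true_iff]
    intro j hj hjt
    exact h ⟨j, by simp [hj, hjt]⟩

theorem prevIdx_lt {ℓ : ℕ} {i : Fin ℓ} (h : 0 < i.val) : prevIdx i < i := by
  simp only [prevIdx, Fin.lt_def]; omega

theorem le_prevIdx {ℓ : ℕ} {i j : Fin ℓ} (h : j < i) : j ≤ prevIdx i := by
  simp only [prevIdx, Fin.le_def, Fin.lt_def] at *; omega

/-- Every object other than the last one with its label is the most recent predecessor, with the
same label, of a later object. -/
theorem exists_sameNeighbor_eq {τ ℓ : ℕ} {t : Fin ℓ → Fin τ} {j k : Fin ℓ} (hjk : j < k)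
    (ht : t k = t j) : ∃ i, sameNeighbor t i = some j := by
  have hne : (univ.filter (fun i : Fin ℓ => j < i ∧ t i = t j)).Nonempty := ⟨k, by simp [hjk, ht]⟩
  refine ⟨(univ.filter (fun i : Fin ℓ => j < i ∧ t i = t j)).min' hne, ?_⟩
  have h1 := Finset.min'_mem _ hne
  simp only [mem_filter, mem_univ, true_and] at h1
  refine sameNeighbor_eq_some.2 ⟨h1.1, h1.2.symm, fun i hi hit => ?_⟩
  by_contra! hlt
  exact absurd hi (not_lt.2 (Finset.min'_le _ _ (by simp [hlt, hit, h1.2])))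

theorem idealParent_cases {τ ℓ : ℕ} {t : Fin ℓ → Fin τ} {i j : Fin ℓ}
    (h : idealParent t i = some j) :
    sameNeighbor t i = some j ∨ (sameNeighbor t i = none ∧ 0 < i.val ∧ j = prevIdx i) := by
  unfold idealParent at h
  cases hs : sameNeighbor t i with
  | some m => rw [hs] at h; left; simpa using h
  | none =>
    right
    rw [hs] at h
    simp only [Option.none_or, prevNeighbor] at h
    split_ifs at h with h0
    exact ⟨rfl, h0, (Option.some.inj h).symm⟩

/-- What holds when the algorithm has processed the indices `i ≥ m`. -/
structure ClusterInvariant {τ ℓ : ℕ} (t : Fin ℓ → Fin τ) (m : ℕ) (s : InfoState ℓ) : Prop where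
  assigned : ∀ i : Fin ℓ, m ≤ i.val → s.label i ≠ none
  of_assigned : ∀ j : Fin ℓ, j.val < m → s.label j ≠ none →
    ∃ i : Fin ℓ, m ≤ i.val ∧ idealParent t i = some j
  same : ∀ i j : Fin ℓ, m ≤ i.val → sameNeighbor t i = some j → s.label j = s.label i
  le_count : ∀ i c, s.label i = some c → c ≤ s.count
  separated : (∀ i, ¬ IsHandover t i) →
    ∀ i j c, s.label i = some c → s.label j = some c → t i = t j

/-- When `i` is processed, the most recent earlier index with its label is still unassigned. -/
theorem ClusterInvariant.label_sameNeighbor {τ ℓ : ℕ} {t : Fin ℓ → Fin τ} {i j : Fin ℓ}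
    {s : InfoState ℓ} (h : ClusterInvariant t (i.val + 1) s) (hj : sameNeighbor t i = some j) :
    s.label j = none := by
  by_contra hne
  obtain ⟨hji, htj, -⟩ := sameNeighbor_eq_some.1 hj
  rw [Fin.lt_def] at hji
  obtain ⟨i', hi', hp⟩ := h.of_assigned j (by omega) hne
  rcases idealParent_cases hp with h1 | ⟨h1, h2, h3⟩
  · obtain ⟨-, h5, h6⟩ := sameNeighbor_eq_some.1 h1
    have := h6 i (by rw [Fin.lt_def]; omega) (by rw [← htj, h5])
    rw [Fin.le_def] at this
    omega
  · have : j.val = i'.val - 1 := by rw [h3]; rfl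
    omega

/-- One pass of the loop preserves the invariant. If the parent of `i` is `i - 1`, with another
label, and there is no handover, then the label of `i - 1` occurs again later, so `i - 1` has
already been assigned and nothing is merged. -/
theorem ClusterInvariant.infoStep {τ ℓ : ℕ} {t : Fin ℓ → Fin τ} {i : Fin ℓ} {s : InfoState ℓ}
    {I : Fin ℓ → Fin ℓ → ℝ} {γ : ℝ} (hI : parent I γ i = idealParent t i)
    (h : ClusterInvariant t (i.val + 1) s) :
    ClusterInvariant t i.val (infoStep I γ s i) := by
  -- opening a cluster for `i` only changes the label of `i`
  obtain ⟨s', hs', hopen, hi', hcount⟩ : ∃ s', s.openCluster i = s' ∧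
      (∀ j, j ≠ i → s'.label j = s.label j) ∧
      ((s.label i ≠ none ∧ s' = s) ∨ (s.label i = none ∧ s'.label i = some (s.count + 1))) ∧
      (∀ j c, s'.label j = some c → c ≤ s'.count) := by
    refine ⟨_, rfl, ?_, ?_, ?_⟩
    · intro j hj
      unfold InfoState.openCluster
      split_ifs <;> simp [hj]
    · unfold InfoState.openCluster
      split_ifs with h0
      · right; simp [h0]
      · left; exact ⟨h0, rfl⟩
    · intro j c hj
      unfold InfoState.openCluster at hj ⊢
      split_ifs at hj ⊢ with h0
      · by_cases hji : j = i
        · subst hji; simp at hj; simp [← hj]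
        · simp only [ne_eq, hji, not_false_eq_true, Function.update_of_ne] at hj
          exact (h.le_count j c hj).trans (Nat.le_succ _)
      · exact h.le_count j c hj
  have hi'_ne : s'.label i ≠ none := by
    rcases hi' with ⟨h1, rfl⟩ | ⟨-, h1⟩
    · exact h1
    · simp [h1]
  have hassigned : ∀ k : Fin ℓ, i.val ≤ k.val → s'.label k ≠ none := by
    intro k hk
    by_cases hki : k = i
    · rwa [hki]
    · rw [hopen k hki]
      exact h.assigned k (by have := Fin.val_ne_of_ne hki; omega)
  have hsame : ∀ k j : Fin ℓ, i.val + 1 ≤ k.val → sameNeighbor t k = some j →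
      s'.label j = s'.label k := by
    intro k j hk hj
    have hki : k ≠ i := by rintro rfl; omega
    by_cases hji : j = i
    · subst hji
      have := h.same k j hk hj
      rcases hi' with ⟨h1, rfl⟩ | ⟨h1, -⟩
      · exact this
      · exact absurd (this ▸ h1) (h.assigned k hk)
    · rw [hopen k hki, hopen j hji]
      exact h.same k j hk hj
  have hsep : (∀ i, ¬ IsHandover t i) →
      ∀ k j c, s'.label k = some c → s'.label j = some c → t k = t j := by
    intro hb
    rcases hi' with ⟨-, rfl⟩ | ⟨-, h1⟩
    · exact h.separated hb
    · intro k j c hk hj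
      by_cases hki : k = i <;> by_cases hji : j = i
      · rw [hki, hji]
      · rw [hki, h1] at hk; rw [hopen j hji] at hj
        have := h.le_count j c hj
        simp at hk; omega
      · rw [hji, h1] at hj; rw [hopen k hki] at hk
        have := h.le_count k c hk
        simp at hj; omega
      · rw [hopen k hki] at hk; rw [hopen j hji] at hj
        exact h.separated hb k j c hk hj
  have hof : ∀ j : Fin ℓ, j.val < i.val → s'.label j ≠ none →
      ∃ k : Fin ℓ, i.val ≤ k.val ∧ idealParent t k = some j := by
    intro j hj hne
    rw [hopen j (by rintro rfl; omega)] at hne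
    obtain ⟨k, hk, hp⟩ := h.of_assigned j (by omega) hne
    exact ⟨k, by omega, hp⟩
  have hunas : ∀ j, sameNeighbor t i = some j → s'.label j = none := by
    intro j hj
    have h1 := (sameNeighbor_eq_some.1 hj).1
    rw [hopen j h1.ne]
    exact h.label_sameNeighbor hj
  unfold _root_.infoStep
  rw [hI, hs']
  cases hp : idealParent t i with
  | none =>
    refine ⟨hassigned, hof, ?_, hcount, hsep⟩
    intro k j hk hj
    by_cases hki : k = i
    · subst hki; simp [idealParent, hj] at hp
    · exact hsame k j (by have := Fin.val_ne_of_ne hki; omega) hj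
  | some j =>
    dsimp only
    have hji : j ≠ i := by
      rcases idealParent_cases hp with h1 | ⟨-, h1, rfl⟩
      · exact (sameNeighbor_eq_some.1 h1).1.ne
      · exact (prevIdx_lt h1).ne
    unfold InfoState.attach
    split_ifs with hj0
    · have hup : ∀ k, k ≠ j → Function.update s'.label j (s'.label i) k = s'.label k :=
        fun k hk => by simp [hk]
      have hupj : Function.update s'.label j (s'.label i) j = s'.label i := by simp
      refine ⟨?_, ?_, ?_, ?_, ?_⟩
      · intro k hk
        by_cases hkj : k = j
        · simpa [hkj] using hi'_ne
        · simpa [hkj] using hassigned k hk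
      · intro k hk hne
        by_cases hkj : k = j
        · exact ⟨i, le_rfl, hkj ▸ hp⟩
        · exact hof k hk (by simpa [hkj] using hne)
      · intro k j' hk hj'
        have hkj : k ≠ j := by rintro rfl; exact hassigned k hk hj0
        dsimp only
        rw [hup k hkj]
        by_cases hki : k = i
        · subst hki
          have : j' = j := by simpa [idealParent, hj'] using hp
          rw [this, hupj]
        · have hk1 : i.val + 1 ≤ k.val := by have := Fin.val_ne_of_ne hki; omega
          have := hsame k j' hk1 hj'
          by_cases hjj : j' = j
          · subst hjj
            exact absurd (this ▸ hj0) (hassigned k hk)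
          · rw [hup j' hjj, this]
      · intro k c hk
        dsimp only at hk ⊢
        by_cases hkj : k = j
        · rw [hkj, hupj] at hk; exact hcount i c hk
        · rw [hup k hkj] at hk; exact hcount k c hk
      · intro hb
        have htij : t j = t i := by
          rcases idealParent_cases hp with h1 | ⟨h1, h2, rfl⟩
          · exact (sameNeighbor_eq_some.1 h1).2.1
          · -- otherwise `i - 1` would already have been assigned through a later object
            exfalso
            have h3 := sameNeighbor_eq_none.1 h1
            refine hb i ⟨h2, h3, fun k hik htk => ?_⟩
            obtain ⟨k', hk'⟩ := exists_sameNeighbor_eq (lt_of_lt_of_le (prevIdx_lt h2) hik) htk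
            obtain ⟨h4, h5, -⟩ := sameNeighbor_eq_some.1 hk'
            have hk'i : k' ≠ i := by rintro rfl; exact h3 _ (prevIdx_lt h2) h5
            have hlt : i.val + 1 ≤ k'.val := by
              have := Fin.val_ne_of_ne hk'i
              simp only [prevIdx, Fin.lt_def] at h4
              omega
            exact hassigned k' (by omega) ((hsame k' _ hlt hk').symm.trans hj0)
        intro k k' c hk hk'
        dsimp only at hk hk'
        by_cases hkj : k = j <;> by_cases hkj' : k' = j
        · rw [hkj, hkj']
        · rw [hkj, hupj] at hk; rw [hup k' hkj'] at hk'
          rw [hkj, htij]; exact hsep hb i k' c hk hk'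
        · rw [hkj', hupj] at hk'; rw [hup k hkj] at hk
          rw [hkj', htij]; exact hsep hb k i c hk hk'
        · rw [hup k hkj] at hk; rw [hup k' hkj'] at hk'
          exact hsep hb k k' c hk hk'
    · refine ⟨hassigned, hof, ?_, hcount, hsep⟩
      intro k j' hk hj'
      by_cases hki : k = i
      · subst hki
        have : j' = j := by simpa [idealParent, hj'] using hp
        subst this
        exact absurd (hunas _ hj') hj0
      · exact hsame k j' (by have := Fin.val_ne_of_ne hki; omega) hj'

theorem clusterInvariant_foldl {τ ℓ : ℕ} {t : Fin ℓ → Fin τ} {I : Fin ℓ → Fin ℓ → ℝ} {γ : ℝ}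
    (hI : ∀ i, parent I γ i = idealParent t i) :
    ClusterInvariant t 0
      ((List.finRange ℓ).reverse.foldl (infoStep I γ) ⟨fun _ => none, 0⟩) := by
  rw [List.foldl_reverse]
  suffices H : ∀ d m, m + d = ℓ → ClusterInvariant t m
      (((List.finRange ℓ).drop m).foldr (fun x y => infoStep I γ y x) ⟨fun _ => none, 0⟩) by
    simpa using H ℓ 0 (by simp)
  intro d
  induction d with
  | zero =>
    intro m hm
    have : (List.finRange ℓ).drop m = [] := by simp; omega
    rw [this]
    refine ⟨fun i hi => ?_, fun j _ hj => ?_, fun i j hi => ?_, fun i c hc => ?_,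
      fun _ i j c hc => ?_⟩
    · have := i.2; omega
    · simp at hj
    · have := i.2; omega
    · simp at hc
    · simp at hc
  | succ d ih =>
    intro m hm
    have hmℓ : m < (List.finRange ℓ).length := by simp; omega
    rw [List.drop_eq_getElem_cons hmℓ, List.foldr_cons]
    have hval : ((List.finRange ℓ)[m]).val = m := by simp
    have := ih (m + 1) (by omega)
    rw [← hval] at this
    have h2 := this.infoStep (hI _)
    rw [hval] at h2
    exact h2

/-- With the ideal parents, objects with the same label end in the same cluster. -/
theorem ker_le_infoPartition {τ ℓ : ℕ} {t : Fin ℓ → Fin τ} {I : Fin ℓ → Fin ℓ → ℝ} {γ : ℝ}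
    (hI : ∀ i, parent I γ i = idealParent t i) : Setoid.ker t ≤ infoPartition I γ := by
  have hinv := clusterInvariant_foldl hI
  unfold infoPartition
  set s := (List.finRange ℓ).reverse.foldl (infoStep I γ) ⟨fun _ => none, 0⟩
  have key : ∀ N : ℕ, ∀ i j : Fin ℓ, i.val ≤ N → j < i → t j = t i → s.label j = s.label i := by
    intro N
    induction N with
    | zero =>
      intro i j hi hj
      rw [Fin.lt_def] at hj; omega
    | succ N ih =>
      intro i j hi hji ht
      cases hs : sameNeighbor t i with
      | none => exact absurd ht (sameNeighbor_eq_none.1 hs j hji)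
      | some m =>
        obtain ⟨h1, h2, h3⟩ := sameNeighbor_eq_some.1 hs
        rw [← hinv.same i m (Nat.zero_le _) hs]
        rcases (h3 j hji ht).lt_or_eq with h4 | h4
        · exact ih m j (by rw [Fin.lt_def] at h1; omega) h4 (ht.trans h2.symm)
        · rw [h4]
  intro x y hxy
  rw [Setoid.ker_def] at hxy ⊢
  rcases lt_trichotomy x y with h | h | h
  · exact key _ y x le_rfl h hxy
  · rw [h]
  · exact (key _ x y le_rfl h hxy.symm).symm

/-- With the ideal parents, the algorithm is correct unless there is a handover. -/
theorem infoPartition_eq_ker {τ ℓ : ℕ} {t : Fin ℓ → Fin τ} {I : Fin ℓ → Fin ℓ → ℝ} {γ : ℝ}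
    (hI : ∀ i, parent I γ i = idealParent t i) (ht : ∀ i, ¬ IsHandover t i) :
    infoPartition I γ = Setoid.ker t := by
  refine le_antisymm ?_ (ker_le_infoPartition hI)
  have hinv := clusterInvariant_foldl hI
  unfold infoPartition
  intro x y hxy
  rw [Setoid.ker_def] at hxy ⊢
  obtain ⟨c, hc⟩ := Option.ne_none_iff_exists'.1 (hinv.assigned x (Nat.zero_le _))
  exact hinv.separated ht x y c hc (hxy ▸ hc)

/-! ### Handovers in a random order -/

/-- In the order `ξ`, the last object with label `a` stands at position `p - 1`, and the first one
with label `b` stands at position `p`. -/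
def IsHandoverAt {τ ℓ : ℕ} (t : Fin ℓ → Fin τ) (a b : Fin τ) (ξ : Equiv.Perm (Fin ℓ))
    (p : Fin ℓ) : Prop :=
  0 < p.val ∧ t (ξ (prevIdx p)) = a ∧ t (ξ p) = b ∧ (∀ k < p, t (ξ k) ≠ b) ∧
    ∀ k, p ≤ k → t (ξ k) ≠ a

/-- Move the object at position `p` to the front, and then exchange it with `x`. -/
def handoverCode {ℓ : ℕ} (x : Fin ℓ) (ξ : Equiv.Perm (Fin ℓ)) (p : Fin ℓ) :
    Equiv.Perm (Fin ℓ) :=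
  Equiv.swap x (ξ p) * ξ * (Fin.cycleRange p)⁻¹

theorem handoverCode_cycleRange {ℓ : ℕ} (x : Fin ℓ) (ξ : Equiv.Perm (Fin ℓ)) (p k : Fin ℓ) :
    handoverCode x ξ p (Fin.cycleRange p k) = Equiv.swap x (ξ p) (ξ k) := by
  simp [handoverCode]

/-- In the coded order, `ξ p` precedes all other objects with label `b`. -/
theorem IsHandoverAt.symm_handoverCode_lt {τ ℓ : ℕ} {t : Fin ℓ → Fin τ} {a b : Fin τ}
    {ξ : Equiv.Perm (Fin ℓ)} {p x y : Fin ℓ} (h : IsHandoverAt t a b ξ p) (hab : a ≠ b)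
    (hx : t x = a) (hy : t y = b) (hyp : y ≠ ξ p) :
    (handoverCode x ξ p).symm (ξ p) < (handoverCode x ξ p).symm y := by
  obtain ⟨h0, h1, h2, h3, h4⟩ := h
  have hyx : y ≠ x := by rintro rfl; exact hab (hx.symm.trans hy)
  have e1 : (handoverCode x ξ p).symm (ξ p) = Fin.cycleRange p (ξ.symm x) := by
    rw [Equiv.symm_apply_eq, handoverCode_cycleRange]; simp
  have e2 : (handoverCode x ξ p).symm y = Fin.cycleRange p (ξ.symm y) := by
    rw [Equiv.symm_apply_eq, handoverCode_cycleRange]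
    simp [Equiv.swap_apply_of_ne_of_ne hyx hyp]
  have l1 : ξ.symm x < p := by
    by_contra! hle
    exact h4 _ hle (by simpa using hx)
  have l2 : p < ξ.symm y := by
    rcases lt_trichotomy p (ξ.symm y) with h | h | h
    · exact h
    · exact absurd (by simp [h]) hyp
    · exact absurd (by simpa using hy) (h3 _ h)
  rw [e1, e2, Fin.cycleRange_of_gt l2, Fin.lt_def, Fin.coe_cycleRange_of_lt l1]
  rw [Fin.lt_def] at l1 l2
  omega

/-- The position of a handover is recovered from the order without its second object. -/
theorem IsHandoverAt.le_of_mul_eq {τ ℓ : ℕ} {t : Fin ℓ → Fin τ} {a b : Fin τ}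
    {ξ ξ' : Equiv.Perm (Fin ℓ)} {p p' : Fin ℓ} (h : IsHandoverAt t a b ξ p)
    (h' : IsHandoverAt t a b ξ' p')
    (he : ξ * (Fin.cycleRange p)⁻¹ = ξ' * (Fin.cycleRange p')⁻¹) : p ≤ p' := by
  obtain ⟨h0, h1, -, -, -⟩ := h
  obtain ⟨-, -, -, -, h4⟩ := h'
  have e1 : Fin.cycleRange p (prevIdx p) = p := by
    ext
    rw [Fin.coe_cycleRange_of_lt (prevIdx_lt h0)]
    simp only [prevIdx]; omega
  have e2 : ξ (prevIdx p) = ξ' ((Fin.cycleRange p').symm p) := by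
    have e1' : (Fin.cycleRange p).symm p = prevIdx p := by rw [Equiv.symm_apply_eq, e1]
    have := congrArg (fun f : Equiv.Perm (Fin ℓ) => f p) he
    simpa only [Equiv.Perm.mul_apply, Equiv.Perm.inv_def, e1'] using this
  have l1 : (Fin.cycleRange p').symm p < p' := by
    by_contra! hle
    exact h4 _ hle (by rw [← e2, h1])
  have : p = Fin.cycleRange p' ((Fin.cycleRange p').symm p) := by simp
  rw [this, Fin.le_def, Fin.coe_cycleRange_of_lt l1]
  exact l1

theorem IsHandoverAt.eq_of_handoverCode_eq {τ ℓ : ℕ} {t : Fin ℓ → Fin τ} {a b : Fin τ}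
    {ξ ξ' : Equiv.Perm (Fin ℓ)} {p p' x : Fin ℓ} (h : IsHandoverAt t a b ξ p)
    (h' : IsHandoverAt t a b ξ' p') (hab : a ≠ b) (hx : t x = a)
    (he : handoverCode x ξ p = handoverCode x ξ' p') : ξ = ξ' := by
  have hy : ξ p = ξ' p' := by
    by_contra hne
    have l1 := h.symm_handoverCode_lt hab hx h'.2.2.1 (Ne.symm hne)
    have l2 := h'.symm_handoverCode_lt hab hx h.2.2.1 hne
    rw [he] at l1
    exact lt_asymm l1 l2
  have hN : ξ * (Fin.cycleRange p)⁻¹ = ξ' * (Fin.cycleRange p')⁻¹ := by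
    unfold handoverCode at he
    rw [hy, mul_assoc, mul_assoc] at he
    exact mul_left_cancel he
  have hp : p = p' := le_antisymm (h.le_of_mul_eq h' hN) (h'.le_of_mul_eq h hN.symm)
  rw [hp] at hN
  exact mul_right_cancel hN

open Classical in
/-- For given distinct labels, a handover occurs in at most a fraction `1 / ℓ` of all orders: the
codes of these orders are distinct, and all of them start with the same object `x`, which may be
put anywhere instead. -/
theorem mul_card_isHandoverAt_le {τ ℓ : ℕ} (t : Fin ℓ → Fin τ) {a b : Fin τ} (hab : a ≠ b) :
    ℓ * (univ.filter (fun ξ : Equiv.Perm (Fin ℓ) => ∃ p, IsHandoverAt t a b ξ p)).card ≤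
      Nat.factorial ℓ := by
  rcases Finset.eq_empty_or_nonempty
    (univ.filter (fun ξ : Equiv.Perm (Fin ℓ) => ∃ p, IsHandoverAt t a b ξ p)) with h0 | ⟨ξ₀, hξ₀⟩
  · simp [h0]
  obtain ⟨p₀, hp₀⟩ := (mem_filter.1 hξ₀).2
  set x := ξ₀ (prevIdx p₀) with hxdef
  have hx : t x = a := hp₀.2.1
  have : NeZero ℓ := ⟨by rintro rfl; exact p₀.elim0⟩
  choose! pos hpos using fun (ξ : Equiv.Perm (Fin ℓ))
    (h : ξ ∈ univ.filter (fun ξ : Equiv.Perm (Fin ℓ) => ∃ p, IsHandoverAt t a b ξ p)) =>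
    (mem_filter.1 h).2
  have hfront : ∀ ξ, handoverCode x ξ (pos ξ) 0 = x := by
    intro ξ
    rw [← Fin.cycleRange_self (pos ξ), handoverCode_cycleRange]; simp
  have hcard : (Fintype.card (Equiv.Perm (Fin ℓ))) = Nat.factorial ℓ := by
    rw [Fintype.card_perm, Fintype.card_fin]
  have hprod : ((univ : Finset (Fin ℓ)) ×ˢ
      (univ.filter (fun ξ : Equiv.Perm (Fin ℓ) => ∃ p, IsHandoverAt t a b ξ p))).card =
      ℓ * (univ.filter (fun ξ : Equiv.Perm (Fin ℓ) => ∃ p, IsHandoverAt t a b ξ p)).card := by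
    rw [card_product, card_univ, Fintype.card_fin]
  rw [← hcard, ← hprod]
  refine Finset.card_le_card_of_injOn
    (fun q => handoverCode x q.2 (pos q.2) * Equiv.swap 0 q.1) (fun _ _ => mem_univ _) ?_
  rintro ⟨s, ξ⟩ h ⟨s', ξ'⟩ h' he
  simp only [coe_product, Set.mem_prod, mem_coe] at h h'
  dsimp only at he
  have hs : s = s' := by
    have e1 : (handoverCode x ξ (pos ξ) * Equiv.swap 0 s) s = x := by simp [hfront]
    have e2 : (handoverCode x ξ' (pos ξ') * Equiv.swap 0 s') s' = x := by simp [hfront]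
    rw [he] at e1
    exact (Equiv.injective _) (e1.trans e2.symm)
  rw [hs] at he
  rw [hs, (hpos ξ h.2).eq_of_handoverCode_eq (hpos ξ' h'.2) hab hx (mul_right_cancel he)]

open Classical in
/-- In a uniformly random order a handover occurs with probability at most `τ ^ 2 / ℓ`. -/
theorem mul_card_isHandover_le {τ ℓ : ℕ} (t : Fin ℓ → Fin τ) :
    ℓ * (univ.filter (fun ξ : Equiv.Perm (Fin ℓ) => ∃ p, IsHandover (t ∘ ξ) p)).card ≤
      τ ^ 2 * Nat.factorial ℓ := by
  have hsub : univ.filter (fun ξ : Equiv.Perm (Fin ℓ) => ∃ p, IsHandover (t ∘ ξ) p) ⊆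
      (univ : Finset (Fin τ × Fin τ)).biUnion (fun q =>
        if q.1 = q.2 then ∅ else
          univ.filter (fun ξ : Equiv.Perm (Fin ℓ) => ∃ p, IsHandoverAt t q.1 q.2 ξ p)) := by
    intro ξ hξ
    obtain ⟨p, h0, h1, h2⟩ := (mem_filter.1 hξ).2
    refine mem_biUnion.2 ⟨(t (ξ (prevIdx p)), t (ξ p)), mem_univ _, ?_⟩
    rw [if_neg (show ¬ t (ξ (prevIdx p)) = t (ξ p) from h1 _ (prevIdx_lt h0))]
    exact mem_filter.2 ⟨mem_univ _, p, h0, rfl, rfl, h1, h2⟩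
  calc _ ≤ ℓ * ∑ q : Fin τ × Fin τ, (if q.1 = q.2 then (∅ : Finset (Equiv.Perm (Fin ℓ))) else
          univ.filter (fun ξ : Equiv.Perm (Fin ℓ) => ∃ p, IsHandoverAt t q.1 q.2 ξ p)).card :=
        Nat.mul_le_mul_left _ ((card_le_card hsub).trans card_biUnion_le)
    _ ≤ ∑ _q : Fin τ × Fin τ, Nat.factorial ℓ := by
        rw [mul_sum]
        refine sum_le_sum fun q _ => ?_
        split_ifs with hq
        · simp
        · exact mul_card_isHandoverAt_le t hq
    _ = τ ^ 2 * Nat.factorial ℓ := by simp [sq]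

/-! ### The law of the responses of a worker with Markov memory -/

/-- Resampling one coordinate: `(y, c) ↦ (update y i c, y i)` is an involution. -/
theorem sum_sum_update {ℓ : ℕ} {R : Type*} [Fintype R] (φ : (Fin ℓ → R) → ℝ) (i : Fin ℓ) :
    ∑ y : Fin ℓ → R, ∑ c, φ (Function.update y i c) = Fintype.card R * ∑ y, φ y := by
  have hinv : Function.Involutive
      (fun q : (Fin ℓ → R) × R => (Function.update q.1 i q.2, q.1 i)) := by
    rintro ⟨y, c⟩
    simp
  have h := Equiv.sum_comp hinv.toPerm (fun q : (Fin ℓ → R) × R => φ q.1)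
  rw [Fintype.sum_prod_type, Fintype.sum_prod_type] at h
  simp only [Function.Involutive.coe_toPerm, sum_const, card_univ, nsmul_eq_mul] at h
  rw [h, mul_sum]

/-- The conditional probability of the answer `c` at index `i`, given the earlier answers in `y`. -/
def MemoryKernel.cond {τ ℓ : ℕ} (K : MemoryKernel τ ℓ) (t : Fin ℓ → Fin τ) (i : Fin ℓ)
    (y : Fin ℓ → Response τ) (c : Response τ) : ℝ :=
  K.prob i ((prevNeighbor i).map y) ((sameNeighbor t i).map y) (t i) c

/-- The joint probability of the answers in `y` at the indices below `m`. -/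
def MemoryKernel.partialLaw {τ ℓ : ℕ} (K : MemoryKernel τ ℓ) (t : Fin ℓ → Fin τ) (m : ℕ)
    (y : Fin ℓ → Response τ) : ℝ :=
  ∏ i ∈ univ.filter (fun i : Fin ℓ => i.val < m), K.cond t i y (y i)

/-- The value of `g` does not depend on the coordinates with index at least `m`. -/
def DependsBelow {ℓ : ℕ} {R A : Type*} (m : ℕ) (g : (Fin ℓ → R) → A) : Prop :=
  ∀ (i : Fin ℓ), m ≤ i.val → ∀ y c, g (Function.update y i c) = g y

theorem MemoryKernel.law_nonneg {τ ℓ : ℕ} (K : MemoryKernel τ ℓ) (t : Fin ℓ → Fin τ)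
    (y : Fin ℓ → Response τ) : 0 ≤ K.law t y :=
  prod_nonneg fun _ _ => K.nonneg _ _ _ _ _

theorem MemoryKernel.cond_update {τ ℓ : ℕ} (K : MemoryKernel τ ℓ) (t : Fin ℓ → Fin τ)
    {i j : Fin ℓ} (hij : i ≤ j) (y : Fin ℓ → Response τ) (c : Response τ) :
    K.cond t i (Function.update y j c) = K.cond t i y := by
  have h1 : (prevNeighbor i).map (Function.update y j c) = (prevNeighbor i).map y := by
    unfold prevNeighbor
    split_ifs with h
    · simp [((prevIdx_lt h).trans_le hij).ne]
    · rfl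
  have h2 : (sameNeighbor t i).map (Function.update y j c) = (sameNeighbor t i).map y := by
    cases hs : sameNeighbor t i with
    | none => rfl
    | some m => simp [((sameNeighbor_eq_some.1 hs).1.trans_le hij).ne]
  funext c
  rw [MemoryKernel.cond, MemoryKernel.cond, h1, h2]

theorem MemoryKernel.sum_cond {τ ℓ : ℕ} (K : MemoryKernel τ ℓ) (t : Fin ℓ → Fin τ)
    (i : Fin ℓ) (y : Fin ℓ → Response τ) : ∑ c, K.cond t i y c = 1 :=
  K.sum_eq_one _ _ _ _

theorem MemoryKernel.dependsBelow_partialLaw {τ ℓ : ℕ} (K : MemoryKernel τ ℓ)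
    (t : Fin ℓ → Fin τ) (m : ℕ) : DependsBelow m (K.partialLaw t m) := by
  intro j hj y c
  refine prod_congr rfl fun i hi => ?_
  have hi := (mem_filter.1 hi).2
  have hij : i < j := by rw [Fin.lt_def]; omega
  rw [K.cond_update t hij.le, Function.update_of_ne hij.ne]

theorem MemoryKernel.partialLaw_succ {τ ℓ : ℕ} (K : MemoryKernel τ ℓ) (t : Fin ℓ → Fin τ)
    (i : Fin ℓ) (y : Fin ℓ → Response τ) :
    K.partialLaw t (i.val + 1) y = K.partialLaw t i.val y * K.cond t i y (y i) := by
  have : univ.filter (fun j : Fin ℓ => j.val < i.val + 1) =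
      insert i (univ.filter (fun j : Fin ℓ => j.val < i.val)) := by
    ext j; simp [Fin.ext_iff]; omega
  rw [partialLaw, this, prod_insert (by simp), mul_comm, partialLaw]

/-- Summing out the answer at index `i`. -/
theorem MemoryKernel.sum_partialLaw_succ {τ ℓ : ℕ} (K : MemoryKernel τ ℓ) (t : Fin ℓ → Fin τ)
    (i : Fin ℓ) {g : (Fin ℓ → Response τ) → ℝ} (hg : DependsBelow i.val g) (e : Response τ → ℝ) :
    Fintype.card (Response τ) * ∑ y, K.partialLaw t (i.val + 1) y * (g y * e (y i)) =
      ∑ y, K.partialLaw t i.val y * (g y * ∑ c, K.cond t i y c * e c) := by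
  rw [← sum_sum_update _ i]
  refine sum_congr rfl fun y _ => ?_
  rw [mul_sum, mul_sum]
  refine sum_congr rfl fun c _ => ?_
  rw [K.partialLaw_succ, K.dependsBelow_partialLaw t i.val i le_rfl, hg i le_rfl,
    K.cond_update t le_rfl, Function.update_self]
  ring

/-- Summing out all answers at the indices from `m` on. -/
theorem MemoryKernel.sum_law_mul {τ ℓ : ℕ} (K : MemoryKernel τ ℓ) (t : Fin ℓ → Fin τ)
    {m d : ℕ} (hm : m + d = ℓ) {g : (Fin ℓ → Response τ) → ℝ} (hg : DependsBelow m g) :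
    (Fintype.card (Response τ) : ℝ) ^ d * ∑ y, K.law t y * g y =
      ∑ y, K.partialLaw t m y * g y := by
  induction d generalizing m with
  | zero =>
    have : univ.filter (fun i : Fin ℓ => i.val < m) = univ := by
      ext i; have := i.2; simp; omega
    simp [MemoryKernel.law, MemoryKernel.partialLaw, MemoryKernel.cond, this]
  | succ d ih =>
    have h1 := ih (m := m + 1) (by omega) (fun i hi => hg i (by omega))
    have h2 := K.sum_partialLaw_succ t ⟨m, by omega⟩ hg (fun _ => 1)
    simp only [mul_one, K.sum_cond] at h2
    rw [← h2, ← h1]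
    ring

theorem MemoryKernel.sum_law {τ ℓ : ℕ} (K : MemoryKernel τ ℓ) (t : Fin ℓ → Fin τ) :
    ∑ y, K.law t y = 1 := by
  have h := K.sum_law_mul t (zero_add ℓ) (g := fun _ => 1) (fun _ _ _ _ => rfl)
  simp only [mul_one, MemoryKernel.partialLaw, not_lt_zero, filter_false, prod_empty, sum_const,
    card_univ, nsmul_eq_mul] at h
  have hpos : (Fintype.card (Response τ) : ℝ) ^ ℓ ≠ 0 := by positivity
  rw [Fintype.card_fun, Fintype.card_fin, Nat.cast_pow] at h
  exact mul_left_cancel₀ hpos (h.trans (mul_one _).symm)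

/-- The Markov property: the answer at `i` may be replaced by its conditional law. -/
theorem MemoryKernel.sum_law_eq_sum_cond {τ ℓ : ℕ} (K : MemoryKernel τ ℓ) (t : Fin ℓ → Fin τ)
    (i : Fin ℓ) {g : (Fin ℓ → Response τ) → ℝ} (hg : DependsBelow i.val g)
    (e : Response τ → ℝ) :
    ∑ y, K.law t y * (g y * e (y i)) = ∑ y, K.law t y * (g y * ∑ c, K.cond t i y c * e c) := by
  obtain ⟨d, hd⟩ := Nat.exists_eq_add_of_lt i.2
  have h1 := K.sum_law_mul t (m := i.val + 1) (d := d) (by omega) (g := fun y => g y * e (y i))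
    (fun j hj y c => by
      have : i ≠ j := by rintro rfl; omega
      simp only [hg j (by omega) y c, Function.update_of_ne this])
  have h2 := K.sum_law_mul t (m := i.val) (d := d + 1) (by omega)
    (g := fun y => g y * ∑ c, K.cond t i y c * e c)
    (fun j hj y c => by simp only [hg j hj y c, K.cond_update t (Fin.le_def.2 hj)])
  have h3 := K.sum_partialLaw_succ t i hg e
  rw [← h1, ← h2, pow_succ'] at h3
  have hpos : (Fintype.card (Response τ) : ℝ) ^ d ≠ 0 := by positivity
  have hpos' : (Fintype.card (Response τ) : ℝ) ≠ 0 := by positivity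
  rw [mul_assoc] at h3
  exact mul_left_cancel₀ hpos (mul_left_cancel₀ hpos' h3)

/-! ### Information about an answer whose only neighbour is the preceding one -/

open Classical in
/-- The probability that `f` takes the value `a` when the pmf on `Ω` is `p`. -/
noncomputable def probEq {Ω A : Type*} [Fintype Ω] (p : Ω → ℝ) (f : Ω → A) (a : A) : ℝ :=
  ∑ ω ∈ univ.filter (fun ω => f ω = a), p ω

theorem entropy_eq_sum_negMulLog {Ω A : Type*} [Fintype Ω] [Fintype A] (p : Ω → ℝ) (f : Ω → A) :
    entropy p f = ∑ a, Real.negMulLog (probEq p f a) := rfl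

theorem sum_probEq_prodMk {Ω A B : Type*} [Fintype Ω] [Fintype B] (p : Ω → ℝ) (f : Ω → A)
    (g : Ω → B) (a : A) : ∑ b, probEq p (fun ω => (f ω, g ω)) (a, b) = probEq p f a := by
  classical
  simp only [probEq]
  rw [← sum_fiberwise_of_maps_to (s := univ.filter (fun ω => f ω = a)) (t := univ) (g := g)
    (fun _ _ => mem_univ _)]
  refine sum_congr rfl fun b _ => sum_congr ?_ fun _ _ => rfl
  ext ω; simp

/-- If the law of `f` given `(g, h)` depends on `g` only, then so does the information of `(g, h)`
about `f`. -/
theorem mutualInfo_eq_of_probEq {Ω A B C : Type*} [Fintype Ω] [Fintype A] [Fintype B] [Fintype C]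
    {p : Ω → ℝ} {f : Ω → A} {g : Ω → B} {h : Ω → C} {q : B → A → ℝ} (hq : ∀ b, ∑ a, q b a = 1)
    (hp : ∀ a b c, probEq p (fun ω => (f ω, (g ω, h ω))) (a, (b, c)) =
      q b a * probEq p (fun ω => (g ω, h ω)) (b, c)) :
    mutualInfo p f (fun ω => (g ω, h ω)) =
      entropy p f - ∑ b, probEq p g b * ∑ a, Real.negMulLog (q b a) := by
  have : entropy p (fun ω => (f ω, (g ω, h ω))) =
      entropy p (fun ω => (g ω, h ω)) + ∑ b, probEq p g b * ∑ a, Real.negMulLog (q b a) := by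
    rw [entropy_eq_sum_negMulLog, entropy_eq_sum_negMulLog, Fintype.sum_prod_type, sum_comm,
      Fintype.sum_prod_type, Fintype.sum_prod_type, ← sum_add_distrib]
    refine sum_congr rfl fun b _ => ?_
    rw [← sum_probEq_prodMk p g h b, sum_mul, ← sum_add_distrib]
    refine sum_congr rfl fun c _ => ?_
    simp only [hp, Real.negMulLog_mul]
    rw [sum_add_distrib, ← mul_sum, ← sum_mul, hq]
    ring
  rw [mutualInfo, this]
  ring

theorem probEq_eq_sum_ite {Ω A : Type*} [Fintype Ω] [DecidableEq A] (p : Ω → ℝ) (f : Ω → A)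
    (a : A) : probEq p f a = ∑ ω, p ω * if f ω = a then 1 else 0 := by
  classical
  simp only [probEq, mul_ite, mul_one, mul_zero, sum_filter]
  exact sum_congr rfl fun _ _ => by congr

/-- If `i` has no neighbour other than `i - 1`, then all pairs `Y_{i-1}, Y_k` carry the same
information about `Y_i`. -/
theorem MemoryKernel.pairInfo_eq {τ ℓ : ℕ} (K : MemoryKernel τ ℓ) (t : Fin ℓ → Fin τ)
    {i k : Fin ℓ} (hk : k < i)
    (hi : sameNeighbor t i = none ∨ sameNeighbor t i = some (prevIdx i)) :
    pairInfo (K.law t) i k = pairInfo (K.law t) i (prevIdx i) := by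
  have h0 : 0 < i.val := by rw [Fin.lt_def] at hk; omega
  obtain ⟨q, hq⟩ : ∃ q : Response τ → Response τ → ℝ,
      ∀ y c, K.cond t i y c = q (y (prevIdx i)) c := by
    rcases hi with hi | hi
    · exact ⟨fun a c => K.prob i (some a) none (t i) c, fun y c => by
        simp [MemoryKernel.cond, prevNeighbor, h0, hi]⟩
    · exact ⟨fun a c => K.prob i (some a) (some a) (t i) c, fun y c => by
        simp [MemoryKernel.cond, prevNeighbor, h0, hi]⟩
  have hq1 : ∀ b, ∑ a, q b a = 1 := fun b => by
    simpa [hq] using K.sum_cond t i (fun _ => b)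
  have key : ∀ k < i, pairInfo (K.law t) i k = entropy (K.law t) (fun y => y i) -
      ∑ b, probEq (K.law t) (fun y => y (prevIdx i)) b * ∑ a, Real.negMulLog (q b a) := by
    intro k hk
    refine mutualInfo_eq_of_probEq hq1 fun a b c => ?_
    have hg : DependsBelow i.val (fun y : Fin ℓ → Response τ =>
        if (y (prevIdx i), y k) = (b, c) then (1 : ℝ) else 0) := by
      intro j hj y x
      have h1 : k ≠ j := (hk.trans_le (Fin.le_def.2 hj)).ne
      have h2 : prevIdx i ≠ j := ((prevIdx_lt h0).trans_le (Fin.le_def.2 hj)).ne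
      simp only [Function.update_of_ne h1, Function.update_of_ne h2]
    have := K.sum_law_eq_sum_cond t i hg (fun x => if x = a then 1 else 0)
    simp only [mul_ite, mul_one, mul_zero, sum_ite_eq', mem_univ, if_true, hq] at this
    rw [probEq_eq_sum_ite, probEq_eq_sum_ite, mul_sum]
    simp only [mul_ite, mul_one, mul_zero, Prod.mk.injEq] at this ⊢
    calc _ = _ := sum_congr rfl fun y _ => by split_ifs <;> simp_all
      _ = _ := this
      _ = _ := sum_congr rfl fun y _ => by
        split_ifs with h
        · rw [h.1]; ring
        · simp
  rw [key k hk, key _ (prevIdx_lt h0)]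

/-! ### Concentration of the empirical law -/

open Classical in
/-- The probability of the event `S` when the pmf on `Ω` is `p`. -/
noncomputable def probOf {Ω : Type*} [Fintype Ω] (p : Ω → ℝ) (S : Ω → Prop) : ℝ :=
  ∑ ω, p ω * if S ω then 1 else 0

theorem probOf_mono {Ω : Type*} [Fintype Ω] {p : Ω → ℝ} (hp : ∀ ω, 0 ≤ p ω) {S T : Ω → Prop}
    (h : ∀ ω, S ω → T ω) : probOf p S ≤ probOf p T := by
  refine sum_le_sum fun ω _ => mul_le_mul_of_nonneg_left ?_ (hp ω)
  by_cases hS : S ω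
  · simp [hS, h ω hS]
  · rw [if_neg hS]; positivity

theorem probOf_or_le {Ω : Type*} [Fintype Ω] {p : Ω → ℝ} (hp : ∀ ω, 0 ≤ p ω) (S T : Ω → Prop) :
    probOf p (fun ω => S ω ∨ T ω) ≤ probOf p S + probOf p T := by
  unfold probOf
  rw [← sum_add_distrib]
  refine sum_le_sum fun ω _ => ?_
  rw [← mul_add]
  refine mul_le_mul_of_nonneg_left ?_ (hp ω)
  by_cases hS : S ω <;> by_cases hT : T ω <;> simp [hS, hT]

theorem probOf_exists_le {Ω ι : Type*} [Fintype Ω] [Fintype ι] {p : Ω → ℝ} (hp : ∀ ω, 0 ≤ p ω)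
    (S : ι → Ω → Prop) : probOf p (fun ω => ∃ i, S i ω) ≤ ∑ i, probOf p (S i) := by
  classical
  unfold probOf
  rw [sum_comm]
  refine sum_le_sum fun ω _ => ?_
  rw [← mul_sum]
  refine mul_le_mul_of_nonneg_left ?_ (hp ω)
  split_ifs with h
  · obtain ⟨i, hi⟩ := h
    refine le_trans ?_ (single_le_sum (fun i _ => ?_) (mem_univ i))
    · simp [hi]
    · positivity
  · positivity

/-- The joint pmf of `n` independent draws from `p`. -/
def productLaw {Ω : Type*} (p : Ω → ℝ) (n : ℕ) (Y : Fin n → Ω) : ℝ := ∏ j, p (Y j)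

theorem productLaw_nonneg {Ω : Type*} {p : Ω → ℝ} (hp : ∀ ω, 0 ≤ p ω) (n : ℕ) (Y : Fin n → Ω) :
    0 ≤ productLaw p n Y :=
  prod_nonneg fun _ _ => hp _

/-- Chernoff bound for a sum of `n` independent copies of a bounded centered random variable on a
finite probability space. -/
theorem probOf_lt_sum_le_exp {Ω : Type*} [Fintype Ω] {p : Ω → ℝ} (hp : ∀ ω, 0 ≤ p ω)
    (hp1 : ∑ ω, p ω = 1) {X : Ω → ℝ} (hX : ∀ ω, |X ω| ≤ 1) (hX0 : ∑ ω, p ω * X ω = 0)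
    {δ : ℝ} (hδ0 : 0 ≤ δ) (hδ1 : δ ≤ 1) (n : ℕ) :
    probOf (productLaw p n) (fun Y => n * δ < ∑ j, X (Y j)) ≤ Real.exp (-(n * δ ^ 2 / 4)) := by
  -- the exponential moment at `δ / 2`, from `exp x ≤ 1 + x + x ^ 2` for `|x| ≤ 1`
  have hmgf : ∑ ω, p ω * Real.exp (δ / 2 * X ω) ≤ Real.exp (δ ^ 2 / 4) := by
    have h1 : ∀ ω, Real.exp (δ / 2 * X ω) ≤ 1 + δ / 2 * X ω + δ ^ 2 / 4 := by
      intro ω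
      have h2 : |δ / 2 * X ω| ≤ 1 := by
        rw [abs_mul, abs_of_nonneg (by positivity)]
        nlinarith [hX ω, abs_nonneg (X ω)]
      have h3 := (abs_le.1 (Real.abs_exp_sub_one_sub_id_le h2)).2
      have h4 : X ω ^ 2 ≤ 1 := (sq_le_one_iff_abs_le_one _).2 (hX ω)
      nlinarith [sq_nonneg δ, mul_le_mul_of_nonneg_left h4 (sq_nonneg δ)]
    calc ∑ ω, p ω * Real.exp (δ / 2 * X ω)
        ≤ ∑ ω, p ω * (1 + δ / 2 * X ω + δ ^ 2 / 4) :=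
          sum_le_sum fun ω _ => mul_le_mul_of_nonneg_left (h1 ω) (hp ω)
      _ = ∑ ω, ((1 + δ ^ 2 / 4) * p ω + δ / 2 * (p ω * X ω)) :=
          sum_congr rfl fun ω _ => by ring
      _ = δ ^ 2 / 4 + 1 := by
          rw [sum_add_distrib, ← mul_sum, ← mul_sum, hp1, hX0]; ring
      _ ≤ _ := Real.add_one_le_exp _
  calc _ ≤ ∑ Y : Fin n → Ω, Real.exp (-(n * δ ^ 2 / 2)) *
        ∏ j, (p (Y j) * Real.exp (δ / 2 * X (Y j))) := by
        refine sum_le_sum fun Y _ => ?_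
        rw [productLaw, prod_mul_distrib, ← Real.exp_sum, ← mul_sum, mul_left_comm, ← Real.exp_add]
        refine mul_le_mul_of_nonneg_left ?_ (prod_nonneg fun _ _ => hp _)
        split_ifs with h
        · refine Real.one_le_exp ?_
          nlinarith
        · positivity
    _ = Real.exp (-(n * δ ^ 2 / 2)) * (∑ ω, p ω * Real.exp (δ / 2 * X ω)) ^ n := by
        rw [← mul_sum, Fintype.sum_pow]
    _ ≤ Real.exp (-(n * δ ^ 2 / 2)) * Real.exp (δ ^ 2 / 4) ^ n := by
        refine mul_le_mul_of_nonneg_left (pow_le_pow_left₀ ?_ hmgf n) (Real.exp_pos _).le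
        exact sum_nonneg fun ω _ => mul_nonneg (hp ω) (Real.exp_pos _).le
    _ = _ := by
        rw [← Real.exp_nat_mul, ← Real.exp_add]
        congr 1; ring

theorem probEq_nonneg {Ω A : Type*} [Fintype Ω] {p : Ω → ℝ} (hp : ∀ ω, 0 ≤ p ω) (f : Ω → A)
    (a : A) : 0 ≤ probEq p f a :=
  sum_nonneg fun ω _ => hp ω

theorem probEq_le_one {Ω A : Type*} [Fintype Ω] {p : Ω → ℝ} (hp : ∀ ω, 0 ≤ p ω)
    (hp1 : ∑ ω, p ω = 1) (f : Ω → A) (a : A) : probEq p f a ≤ 1 :=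
  hp1 ▸ sum_le_sum_of_subset_of_nonneg (subset_univ _) fun ω _ _ => hp ω

theorem empiricalLaw_nonneg {τ ℓ n : ℕ} (Y : Fin n → Fin ℓ → Response τ)
    (y : Fin ℓ → Response τ) : 0 ≤ empiricalLaw Y y := by
  unfold empiricalLaw; positivity

open Classical in
theorem probEq_empiricalLaw {τ ℓ n : ℕ} {A : Type*} (Y : Fin n → Fin ℓ → Response τ)
    (f : (Fin ℓ → Response τ) → A) (a : A) :
    probEq (empiricalLaw Y) f a = (∑ j, if f (Y j) = a then (1 : ℝ) else 0) / n := by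
  simp only [probEq, empiricalLaw]
  rw [← sum_div, ← Nat.cast_sum, sum_boole]
  congr 2
  rw [card_eq_sum_card_fiberwise (f := Y) (t := univ.filter (fun ω => f ω = a))
    (fun j hj => by simpa using hj)]
  refine sum_congr rfl fun y hy => ?_
  congr 1
  ext j
  simp only [mem_filter, mem_univ, true_and] at hy ⊢
  exact ⟨fun h => ⟨h ▸ hy, h⟩, fun h => h.2⟩

theorem sum_empiricalLaw {τ ℓ n : ℕ} (hn : 0 < n) (Y : Fin n → Fin ℓ → Response τ) :
    ∑ y, empiricalLaw Y y = 1 := by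
  have := probEq_empiricalLaw Y (fun _ => ()) ()
  simpa [probEq, hn.ne'] using this

/-- The empirical law of a random variable `f` with values in `A` is uniformly close to its law,
except with probability `2 |A| exp (-n δ² / 4)`. -/
theorem probOf_probEq_empiricalLaw_le {τ ℓ n : ℕ} (hn : 0 < n) {A : Type*} [Fintype A]
    {p : (Fin ℓ → Response τ) → ℝ} (hp : ∀ ω, 0 ≤ p ω) (hp1 : ∑ ω, p ω = 1)
    (f : (Fin ℓ → Response τ) → A) {δ : ℝ} (hδ0 : 0 ≤ δ) (hδ1 : δ ≤ 1) :
    probOf (productLaw p n) (fun Y => ∃ a, δ < |probEq (empiricalLaw Y) f a - probEq p f a|) ≤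
      2 * Fintype.card A * Real.exp (-(n * δ ^ 2 / 4)) := by
  classical
  have hn' : (0 : ℝ) < n := by exact_mod_cast hn
  set X : A → (Fin ℓ → Response τ) → ℝ :=
    fun a ω => (if f ω = a then 1 else 0) - probEq p f a with hXdef
  have hX : ∀ a ω, |X a ω| ≤ 1 := by
    intro a ω
    have h0 := probEq_nonneg hp f a
    have h1 := probEq_le_one hp hp1 f a
    rw [abs_le]
    simp only [hXdef]
    split_ifs <;> constructor <;> linarith
  have hX0 : ∀ a, ∑ ω, p ω * X a ω = 0 := by
    intro a
    simp only [hXdef, mul_sub, sum_sub_distrib]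
    rw [← sum_mul, hp1, ← probEq_eq_sum_ite]
    ring
  have hsum : ∀ a (Y : Fin n → Fin ℓ → Response τ),
      ∑ j, X a (Y j) = n * (probEq (empiricalLaw Y) f a - probEq p f a) := by
    intro a Y
    have := probEq_empiricalLaw Y f a
    simp only [hXdef, sum_sub_distrib, sum_const, card_univ, Fintype.card_fin, nsmul_eq_mul]
    rw [mul_sub, this, mul_div_cancel₀ _ hn'.ne']
  have hXn0 : ∀ a, ∑ ω, p ω * (-X a ω) = 0 := fun a => by
    simp only [mul_neg, sum_neg_distrib, hX0, neg_zero]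
  have hP := productLaw_nonneg hp n
  calc _ ≤ probOf (productLaw p n)
        (fun Y => ∃ a, n * δ < ∑ j, X a (Y j) ∨ n * δ < ∑ j, -X a (Y j)) := by
        refine probOf_mono hP fun Y => ?_
        rintro ⟨a, ha⟩
        refine ⟨a, (lt_abs.1 ha).imp (fun h => ?_) fun h => ?_⟩
        · rw [hsum]; exact mul_lt_mul_of_pos_left h hn'
        · rw [sum_neg_distrib, hsum, ← mul_neg]; exact mul_lt_mul_of_pos_left h hn'
    _ ≤ ∑ _a : A, (Real.exp (-(n * δ ^ 2 / 4)) + Real.exp (-(n * δ ^ 2 / 4))) := by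
        refine (probOf_exists_le hP _).trans (sum_le_sum fun a _ =>
          (probOf_or_le hP _ _).trans (add_le_add ?_ ?_))
        · exact probOf_lt_sum_le_exp hp hp1 (hX a) (hX0 a) hδ0 hδ1 n
        · exact probOf_lt_sum_le_exp hp hp1 (X := fun ω => -X a ω)
            (fun ω => by rw [abs_neg]; exact hX a ω) (hXn0 a) hδ0 hδ1 n
    _ = _ := by
        simp only [sum_const, card_univ, nsmul_eq_mul]; ring

/-! ### Continuity of entropy and mutual information -/

/-- Modulus of continuity of `x log x` on the unit interval. -/
theorem abs_negMulLog_sub_le {x y δ : ℝ} (hx0 : 0 ≤ x) (hx1 : x ≤ 1) (hy0 : 0 ≤ y) (hy1 : y ≤ 1)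
    (hδ1 : δ ≤ 1) (h : |x - y| ≤ δ) :
    |Real.negMulLog x - Real.negMulLog y| ≤ δ * (1 - Real.log δ) := by
  wlog hxy : x ≤ y generalizing x y
  · rw [abs_sub_comm]
    exact this hy0 hy1 hx0 hx1 (by rwa [abs_sub_comm]) (le_of_not_ge hxy)
  have hδ0 : 0 ≤ δ := (abs_nonneg _).trans h
  have hlogδ : Real.log δ ≤ 0 := Real.log_nonpos hδ0 hδ1
  rcases hxy.eq_or_lt with rfl | hlt
  · simp only [sub_self, abs_zero]
    exact mul_nonneg hδ0 (by linarith)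
  have hd : 0 < y - x := sub_pos.2 hlt
  have hdδ : y - x ≤ δ := by rw [abs_sub_comm, abs_of_pos hd] at h; exact h
  have hδ : 0 < δ := hd.trans_le hdδ
  have hy : 0 < y := hx0.trans_lt hlt
  have hlogy : Real.log y ≤ 0 := Real.log_nonpos hy0 hy1
  -- the increment of `x log x` is controlled by `log x ≤ log y` and `log (y / x) ≤ y / x - 1`
  have hle : x * Real.log x ≤ x * Real.log y := by
    rcases hx0.eq_or_lt with rfl | hx
    · simp
    · exact mul_le_mul_of_nonneg_left (Real.log_le_log hx hxy) hx0
  have hge : x * Real.log y - x * Real.log x ≤ y - x := by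
    rcases hx0.eq_or_lt with rfl | hx
    · simpa using hy0
    · have := Real.log_le_sub_one_of_pos (div_pos hy hx)
      rw [Real.log_div hy.ne' hx.ne'] at this
      calc _ = x * (Real.log y - Real.log x) := by ring
        _ ≤ x * (y / x - 1) := mul_le_mul_of_nonneg_left this hx0
        _ = y - x := by field_simp
  have hlogd : Real.log (y - x) ≤ Real.log y := Real.log_le_log hd (by linarith)
  have hent : -((y - x) * Real.log (y - x)) ≤ δ * (1 - Real.log δ) := by
    have := Real.log_le_sub_one_of_pos (div_pos hδ hd)
    rw [Real.log_div hδ.ne' hd.ne'] at this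
    have h2 : (y - x) * (Real.log δ - Real.log (y - x)) ≤ δ - (y - x) := by
      calc _ ≤ (y - x) * (δ / (y - x) - 1) := mul_le_mul_of_nonneg_left this hd.le
        _ = _ := by field_simp
    nlinarith
  unfold Real.negMulLog
  rw [abs_le]
  constructor
  · nlinarith
  · nlinarith

theorem abs_entropy_sub_le {Ω A : Type*} [Fintype Ω] [Fintype A] {p q : Ω → ℝ}
    (hp : ∀ ω, 0 ≤ p ω) (hp1 : ∑ ω, p ω = 1) (hq : ∀ ω, 0 ≤ q ω) (hq1 : ∑ ω, q ω = 1)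
    {f : Ω → A} {δ : ℝ} (hδ1 : δ ≤ 1) (h : ∀ a, |probEq q f a - probEq p f a| ≤ δ) :
    |entropy q f - entropy p f| ≤ Fintype.card A * (δ * (1 - Real.log δ)) := by
  rw [entropy_eq_sum_negMulLog, entropy_eq_sum_negMulLog, ← sum_sub_distrib]
  refine (abs_sum_le_sum_abs _ _).trans ?_
  rw [← nsmul_eq_mul, ← card_univ, ← sum_const]
  exact sum_le_sum fun a _ => abs_negMulLog_sub_le (probEq_nonneg hq f a)
    (probEq_le_one hq hq1 f a) (probEq_nonneg hp f a) (probEq_le_one hp hp1 f a) hδ1 (h a)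

/-- The number of values taken by an answer, by a pair of answers and by a triple of answers. -/
def numCells (τ : ℕ) : ℝ := (τ + 1) + (τ + 1) ^ 2 + (τ + 1) ^ 3

theorem numCells_pos (τ : ℕ) : 0 < numCells τ := by unfold numCells; positivity

theorem abs_pairInfo_sub_le {τ ℓ : ℕ} {p q : (Fin ℓ → Response τ) → ℝ}
    (hp : ∀ ω, 0 ≤ p ω) (hp1 : ∑ ω, p ω = 1) (hq : ∀ ω, 0 ≤ q ω) (hq1 : ∑ ω, q ω = 1)
    {i j : Fin ℓ} {δ : ℝ} (hδ1 : δ ≤ 1)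
    (h1 : ∀ a, |probEq q (fun y => y i) a - probEq p (fun y => y i) a| ≤ δ)
    (h2 : ∀ a, |probEq q (fun y => (y (prevIdx i), y j)) a -
      probEq p (fun y => (y (prevIdx i), y j)) a| ≤ δ)
    (h3 : ∀ a, |probEq q (fun y => (y i, (y (prevIdx i), y j))) a -
      probEq p (fun y => (y i, (y (prevIdx i), y j))) a| ≤ δ) :
    |pairInfo q i j - pairInfo p i j| ≤ numCells τ * (δ * (1 - Real.log δ)) := by
  have e1 := abs_entropy_sub_le hp hp1 hq hq1 hδ1 h1
  have e2 := abs_entropy_sub_le hp hp1 hq hq1 hδ1 h2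
  have e3 := abs_entropy_sub_le hp hp1 hq hq1 hδ1 h3
  simp only [Fintype.card_prod, Fintype.card_option, Fintype.card_fin, Nat.cast_mul,
    Nat.cast_add, Nat.cast_one] at e1 e2 e3
  unfold pairInfo mutualInfo
  generalize entropy q (fun y => y i) = q1 at *
  generalize entropy p (fun y => y i) = p1 at *
  generalize entropy q (fun y => (y (prevIdx i), y j)) = q2 at *
  generalize entropy p (fun y => (y (prevIdx i), y j)) = p2 at *
  generalize entropy q (fun y => (y i, (y (prevIdx i), y j))) = q3 at *
  generalize entropy p (fun y => (y i, (y (prevIdx i), y j))) = p3 at *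
  generalize δ * (1 - Real.log δ) = ω at *
  have : numCells τ * ω = (τ + 1) * ω + (τ + 1) * (τ + 1) * ω +
      (τ + 1) * ((τ + 1) * (τ + 1)) * ω := by unfold numCells; ring
  rw [this]
  rw [abs_le] at *
  constructor <;> linarith

/-- Concentration of the plug-in estimates of all information values. -/
theorem probOf_pairInfo_empiricalLaw_le {τ ℓ n : ℕ} (hn : 0 < n)
    {p : (Fin ℓ → Response τ) → ℝ} (hp : ∀ ω, 0 ≤ p ω) (hp1 : ∑ ω, p ω = 1)
    {δ η : ℝ} (hδ0 : 0 ≤ δ) (hδ1 : δ ≤ 1) (hη : numCells τ * (δ * (1 - Real.log δ)) ≤ η) :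
    probOf (productLaw p n)
      (fun Y => ∃ q : Fin ℓ × Fin ℓ,
        η < |pairInfo (empiricalLaw Y) q.1 q.2 - pairInfo p q.1 q.2|) ≤
      (ℓ : ℝ) ^ 2 * (2 * numCells τ * Real.exp (-(n * δ ^ 2 / 4))) := by
  have hP := productLaw_nonneg hp n
  have hpair : ∀ i j : Fin ℓ, probOf (productLaw p n)
      (fun Y => η < |pairInfo (empiricalLaw Y) i j - pairInfo p i j|) ≤
      2 * numCells τ * Real.exp (-(n * δ ^ 2 / 4)) := by
    intro i j
    have h1 := probOf_probEq_empiricalLaw_le hn hp hp1 (fun y => y i) hδ0 hδ1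
    have h2 := probOf_probEq_empiricalLaw_le hn hp hp1 (fun y => (y (prevIdx i), y j)) hδ0 hδ1
    have h3 := probOf_probEq_empiricalLaw_le hn hp hp1
      (fun y => (y i, (y (prevIdx i), y j))) hδ0 hδ1
    simp only [Fintype.card_prod, Fintype.card_option, Fintype.card_fin, Nat.cast_mul,
      Nat.cast_add, Nat.cast_one] at h1 h2 h3
    refine (probOf_mono hP ?_).trans ((probOf_or_le hP _ _).trans
      ((add_le_add h1 ((probOf_or_le hP _ _).trans (add_le_add h2 h3))).trans_eq ?_))
    · intro Y hY
      by_contra! hc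
      exact absurd hY (not_lt.2 ((abs_pairInfo_sub_le hp hp1 (empiricalLaw_nonneg Y)
        (sum_empiricalLaw hn Y) hδ1 hc.1 hc.2.1 hc.2.2).trans hη))
    · unfold numCells; ring
  calc _ ≤ ∑ q : Fin ℓ × Fin ℓ, 2 * numCells τ * Real.exp (-(n * δ ^ 2 / 4)) :=
        (probOf_exists_le hP _).trans (sum_le_sum fun q _ => hpair q.1 q.2)
    _ = _ := by
        simp only [sum_const, card_univ, nsmul_eq_mul, Fintype.card_prod, Fintype.card_fin,
          Nat.cast_mul]
        ring

/-! ### Accurate estimates give the ideal parents -/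

theorem parent_eq_some {ℓ : ℕ} {I : Fin ℓ → Fin ℓ → ℝ} {γ : ℝ} {i m : Fin ℓ} (hm : m < i)
    (hI : ∀ k < i, I i k - γ ≤ I i m)
    (hmax : ∀ j < i, (∀ k < i, I i k - γ ≤ I i j) → j ≤ m) : parent I γ i = some m := by
  classical
  have hne : (univ.filter (fun j : Fin ℓ => j < i ∧ ∀ k, k < i → I i k - γ ≤ I i j)).Nonempty :=
    ⟨m, mem_filter.2 ⟨mem_univ _, hm, hI⟩⟩
  unfold parent
  rw [dif_pos (by convert hne)]
  congr 1
  refine le_antisymm ?_ (Finset.le_max' _ _ (mem_filter.2 ⟨mem_univ _, hm, hI⟩))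
  refine Finset.max'_le _ _ _ fun j hj => ?_
  obtain ⟨-, h1, h2⟩ := mem_filter.1 hj
  exact hmax j h1 h2

theorem parent_eq_none {ℓ : ℕ} {I : Fin ℓ → Fin ℓ → ℝ} {γ : ℝ} {i : Fin ℓ} (hi : i.val = 0) :
    parent I γ i = none := by
  unfold parent
  rw [dif_neg]
  rintro ⟨j, hj⟩
  have := (mem_filter.1 hj).2.1
  rw [Fin.lt_def] at this
  omega

theorem pairInfo_add_two_mul_le {τ ℓ : ℕ} {p : (Fin ℓ → Response τ) → ℝ} {t : Fin ℓ → Fin τ}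
    {θ : ℝ} (hθ : (θ : EReal) ≤ seqMemoryQuality p t) {i m j : Fin ℓ} (hm : TwoNeighbors t i m)
    (hj : j < i) (hjm : j ≠ m) : pairInfo p i j + 2 * θ ≤ pairInfo p i m := by
  have h1 : (⨅ (i : Fin ℓ) (m : Fin ℓ) (_ : TwoNeighbors t i m), ((pairInfo p i m : ℝ) : EReal)) ≤
      ((pairInfo p i m : ℝ) : EReal) := iInf_le_of_le i (iInf₂_le m hm)
  have h2 : ((pairInfo p i j : ℝ) : EReal) ≤ ⨆ (i : Fin ℓ) (m : Fin ℓ) (_ : TwoNeighbors t i m)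
      (j : Fin ℓ) (_ : j < i ∧ j ≠ m), ((pairInfo p i j : ℝ) : EReal) :=
    le_iSup_of_le i (le_iSup_of_le m (le_iSup_of_le hm (le_iSup₂_of_le j ⟨hj, hjm⟩ le_rfl)))
  have h3 : (θ : EReal) ≤ (((pairInfo p i m - pairInfo p i j) / 2 : ℝ) : EReal) := by
    refine hθ.trans ((EReal.div_le_div_right_of_nonneg (by norm_num)
      (EReal.sub_le_sub h1 h2)).trans_eq ?_)
    rw [EReal.coe_div, EReal.coe_sub]
    rfl
  have h4 := EReal.coe_le_coe_iff.1 h3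
  linarith

/-- If all information values are known with accuracy `γ / 2`, and `γ` is below the memory quality,
then the algorithm finds the ideal parents. -/
theorem parent_eq_idealParent {τ ℓ : ℕ} (K : MemoryKernel τ ℓ) {t : Fin ℓ → Fin τ}
    {I : Fin ℓ → Fin ℓ → ℝ} {γ θ : ℝ} (hγθ : γ < θ)
    (hθ : (θ : EReal) ≤ seqMemoryQuality (K.law t) t)
    (hI : ∀ i j, |I i j - pairInfo (K.law t) i j| ≤ γ / 2) (i : Fin ℓ) :
    parent I γ i = idealParent t i := by
  have hI1 := fun i j => (abs_le.1 (hI i j)).1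
  have hI2 := fun i j => (abs_le.1 (hI i j)).2
  rcases Nat.eq_zero_or_pos i.val with h0 | h0
  · have hs : sameNeighbor t i = none := by
      refine sameNeighbor_eq_none.2 fun j hj => ?_
      rw [Fin.lt_def] at hj; omega
    rw [parent_eq_none h0, idealParent, hs]
    simp [prevNeighbor, h0]
  by_cases hm : ∃ m, TwoNeighbors t i m
  · obtain ⟨m, hm⟩ := hm
    have hmi := (sameNeighbor_eq_some.1 hm.1).1
    have hgap : ∀ j < i, j ≠ m → I i j + γ < I i m := by
      intro j hj hjm
      have h1 := pairInfo_add_two_mul_le hθ hm hj hjm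
      have h2 := hI2 i j
      have h3 := hI1 i m
      linarith
    have hγ0 : 0 ≤ γ := by have := (abs_nonneg _).trans (hI i i); linarith
    rw [idealParent, hm.1, Option.some_or]
    refine parent_eq_some hmi (fun k hk => ?_) fun j hj h => ?_
    · by_cases hkm : k = m
      · rw [hkm]; linarith
      · have := hgap k hk hkm; linarith
    · by_contra! hlt
      have h1 := hgap j hj hlt.ne'
      have h2 := h m hmi
      linarith
  · have hs : sameNeighbor t i = none ∨ sameNeighbor t i = some (prevIdx i) := by
      cases hs : sameNeighbor t i with
      | none => exact Or.inl rfl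
      | some m =>
        right
        by_contra hne
        exact hm ⟨m, hs, fun h => hne (by rw [h])⟩
    have hid : idealParent t i = some (prevIdx i) := by
      rcases hs with hs | hs <;> simp [idealParent, hs, prevNeighbor, h0]
    rw [hid]
    refine parent_eq_some (prevIdx_lt h0) (fun k hk => ?_) fun j hj _ => le_prevIdx hj
    have h1 := K.pairInfo_eq t hk hs
    have h2 := hI2 i k
    have h3 := hI1 i (prevIdx i)
    linarith

/-! ### The error probability -/

theorem comap_symm_ker {τ ℓ : ℕ} (t : Fin ℓ → Fin τ) (ξ : Equiv.Perm (Fin ℓ)) :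
    Setoid.comap ξ.symm (Setoid.ker (t ∘ ξ)) = correctPartition t := by
  ext x y
  change t (ξ (ξ.symm x)) = t (ξ (ξ.symm y)) ↔ t x = t y
  simp

/-- If every round merges true clusters only, and some round is correct, then so is the output. -/
theorem memDecoder_eq_some {τ ℓ n k : ℕ} {γ : ℝ} {ξ : Fin k → Equiv.Perm (Fin ℓ)}
    {Y : Fin k → Fin n → Fin ℓ → Response τ} {t : Fin ℓ → Fin τ}
    (hI : ∀ r i, parent (pairInfo (empiricalLaw (Y r))) γ i = idealParent (t ∘ ξ r) i)
    (hξ : ∃ r, ∀ i, ¬ IsHandover (t ∘ ξ r) i) :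
    memDecoder γ ξ Y = some (correctPartition t) := by
  have hle : ∀ r, correctPartition t ≤ roundPartition γ (ξ r) (Y r) := by
    intro r
    have h := ker_le_infoPartition (hI r)
    rw [← comap_symm_ker t (ξ r), roundPartition]
    generalize infoPartition (pairInfo (empiricalLaw (Y r))) γ = P at h
    exact fun x y hxy => h hxy
  obtain ⟨r, hr⟩ := hξ
  have heq : roundPartition γ (ξ r) (Y r) = correctPartition t := by
    rw [← comap_symm_ker t (ξ r), roundPartition, infoPartition_eq_ker (hI r) hr]
  have hex : ∃ r, ∀ s, roundPartition γ (ξ r) (Y r) ≤ roundPartition γ (ξ s) (Y s) :=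
    ⟨r, fun s => by rw [heq]; exact hle s⟩
  unfold memDecoder
  rw [dif_pos hex, Option.some.injEq]
  refine le_antisymm ?_ (hle _)
  have := hex.choose_spec r
  rwa [heq] at this

theorem sum_prod_eq_one {Ω : Type*} [Fintype Ω] {k : ℕ} {F : Fin k → Ω → ℝ}
    (hF : ∀ r, ∑ ω, F r ω = 1) : ∑ Y : Fin k → Ω, ∏ r, F r (Y r) = 1 := by
  classical
  rw [← Fintype.piFinset_univ, ← Finset.prod_univ_sum]
  simp [hF]

/-- An event about a single coordinate, under a product law. -/
theorem probOf_prod_eq {Ω : Type*} [Fintype Ω] {k : ℕ} {F : Fin k → Ω → ℝ}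
    (hF : ∀ r, ∑ ω, F r ω = 1) (r : Fin k) (S : Ω → Prop) :
    probOf (fun Y : Fin k → Ω => ∏ s, F s (Y s)) (fun Y => S (Y r)) = probOf (F r) S := by
  classical
  have h : ∀ Y : Fin k → Ω, (∏ s, F s (Y s)) * (if S (Y r) then 1 else 0) =
      ∏ s, (F s (Y s) * if s = r then (if S (Y s) then 1 else 0) else 1) := by
    intro Y
    rw [prod_mul_distrib, Fintype.prod_ite_eq']
  calc _ = ∑ Y : Fin k → Ω, (∏ s, F s (Y s)) * (if S (Y r) then 1 else 0) :=
        sum_congr rfl fun _ _ => by congr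
    _ = ∏ s, ∑ ω, (F s ω * if s = r then (if S ω then 1 else 0) else 1) := by
        rw [Finset.prod_univ_sum, Fintype.piFinset_univ]
        exact sum_congr rfl fun Y _ => h Y
    _ = ∏ s, if s = r then probOf (F s) S else 1 := by
        refine prod_congr rfl fun s _ => ?_
        split_ifs with hs
        · exact sum_congr rfl fun _ _ => by congr
        · simp [hF]
    _ = _ := by rw [Fintype.prod_ite_eq']

open Classical in
/-- All `k` independent orders have a handover with probability at most `(τ ^ 2 / ℓ) ^ k`. -/
theorem sum_ite_forall_isHandover_le {τ ℓ k : ℕ} (hℓ : 0 < ℓ) (t : Fin ℓ → Fin τ) :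
    ∑ ξ : Fin k → Equiv.Perm (Fin ℓ), (1 / (Nat.factorial ℓ : ℝ)) ^ k *
      (if ∀ r, ∃ i, IsHandover (t ∘ ξ r) i then 1 else 0) ≤ ((τ : ℝ) ^ 2 / ℓ) ^ k := by
  have h : ∀ ξ : Fin k → Equiv.Perm (Fin ℓ), (1 / (Nat.factorial ℓ : ℝ)) ^ k *
      (if ∀ r, ∃ i, IsHandover (t ∘ ξ r) i then 1 else 0) =
      ∏ r, (1 / (Nat.factorial ℓ : ℝ) * if ∃ i, IsHandover (t ∘ ξ r) i then 1 else 0) := by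
    intro ξ
    rw [prod_mul_distrib, prod_const, card_univ, Fintype.card_fin]
    congr 1
    rw [prod_boole]
    simp
  rw [sum_congr rfl fun ξ _ => h ξ, ← Fintype.sum_pow
    (fun ξ : Equiv.Perm (Fin ℓ) => 1 / (Nat.factorial ℓ : ℝ) *
      if ∃ i, IsHandover (t ∘ ξ) i then 1 else 0)]
  refine pow_le_pow_left₀ (sum_nonneg fun _ _ => by positivity) ?_ k
  rw [← mul_sum, sum_boole, one_div, inv_mul_eq_div,
    div_le_div_iff₀ (by positivity) (by positivity)]
  have := mul_card_isHandover_le t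
  rw [mul_comm]
  exact_mod_cast this

/-- The output is correct unless every round has a handover, or the estimates of some round are
inaccurate. -/
theorem errorProb_le {τ ℓ : ℕ} {W : Type*} [MeasurableSpace W] {pool : WorkerPool τ ℓ W}
    (hpool : pool.MeanIsMarkov) {PT : Fin τ → ℝ} (hPT : PT ∈ stdSimplex ℝ (Fin τ)) (hℓ : 0 < ℓ)
    {θ c₁ α δ : ℝ} {k n : ℕ} (hθ : (θ : EReal) ≤ pool.memoryQuality PT)
    (hγθ : threshold c₁ α n < θ) (hn : 0 < n) (hδ0 : 0 ≤ δ) (hδ1 : δ ≤ 1)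
    (hδ : numCells τ * (δ * (1 - Real.log δ)) ≤ threshold c₁ α n / 2) :
    pool.errorProb PT c₁ α k n ≤ ((τ : ℝ) ^ 2 / ℓ) ^ k +
      k * ((ℓ : ℝ) ^ 2 * (2 * numCells τ * Real.exp (-(n * δ ^ 2 / 4)))) := by
  classical
  obtain ⟨K, hK⟩ := hpool
  have hmean : ∀ t, pool.meanLaw t = K.law t := fun t => funext (hK t)
  set B := (ℓ : ℝ) ^ 2 * (2 * numCells τ * Real.exp (-(n * δ ^ 2 / 4))) with hB
  -- the conditional error probability, given the labels and the orders
  have hround : ∀ t : Fin ℓ → Fin τ, (∀ i, 0 < PT (t i)) → ∀ ξ : Fin k → Equiv.Perm (Fin ℓ),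
      ∑ Y : Fin k → Fin n → Fin ℓ → Response τ,
        (∏ r, ∏ j, pool.meanLaw (t ∘ ξ r) (Y r j)) *
          (if memDecoder (threshold c₁ α n) ξ Y = some (correctPartition t) then (0 : ℝ) else 1) ≤
      (if ∀ r, ∃ i, IsHandover (t ∘ ξ r) i then 1 else 0) + k * B := by
    intro t ht ξ
    set F : Fin k → (Fin n → Fin ℓ → Response τ) → ℝ :=
      fun r => productLaw (K.law (t ∘ ξ r)) n with hF
    have hF0 : ∀ Y : Fin k → Fin n → Fin ℓ → Response τ, 0 ≤ ∏ r, F r (Y r) :=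
      fun Y => prod_nonneg fun r _ => productLaw_nonneg (K.law_nonneg _) n _
    have hF1 : ∀ r, ∑ Y, F r Y = 1 := fun r => sum_prod_eq_one fun _ => K.sum_law _
    set S : Fin k → (Fin n → Fin ℓ → Response τ) → Prop := fun r Y => ∃ q : Fin ℓ × Fin ℓ,
      threshold c₁ α n / 2 <
        |pairInfo (empiricalLaw Y) q.1 q.2 - pairInfo (K.law (t ∘ ξ r)) q.1 q.2| with hS
    have hsplit : ∀ Y : Fin k → Fin n → Fin ℓ → Response τ,
        (if memDecoder (threshold c₁ α n) ξ Y = some (correctPartition t) then (0 : ℝ) else 1) ≤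
        (if ∀ r, ∃ i, IsHandover (t ∘ ξ r) i then 1 else 0) +
          (if ∃ r, S r (Y r) then 1 else 0) := by
      intro Y
      by_cases h1 : ∀ r, ∃ i, IsHandover (t ∘ ξ r) i
      · rw [if_pos h1]; split_ifs <;> norm_num
      by_cases h2 : ∃ r, S r (Y r)
      · rw [if_pos h2]; split_ifs <;> norm_num
      rw [if_pos]
      · positivity
      push Not at h1
      refine memDecoder_eq_some (fun r => ?_) h1
      refine parent_eq_idealParent K (t := t ∘ ξ r) hγθ ?_ ?_
      · rw [← hmean]
        exact hθ.trans (iInf₂_le (t ∘ ξ r) fun i => ht _)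
      · intro i j
        by_contra! hlt
        exact h2 ⟨r, (i, j), hlt⟩
    calc _ ≤ ∑ Y : Fin k → Fin n → Fin ℓ → Response τ, (∏ r, F r (Y r)) *
          ((if ∀ r, ∃ i, IsHandover (t ∘ ξ r) i then 1 else 0) +
            (if ∃ r, S r (Y r) then 1 else 0)) := by
          refine sum_le_sum fun Y _ => ?_
          simp only [hmean]
          exact mul_le_mul_of_nonneg_left (hsplit Y) (hF0 Y)
      _ = (if ∀ r, ∃ i, IsHandover (t ∘ ξ r) i then 1 else 0) +
          probOf (fun Y : Fin k → Fin n → Fin ℓ → Response τ => ∏ r, F r (Y r))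
            (fun Y => ∃ r, S r (Y r)) := by
          simp only [mul_add, sum_add_distrib]
          rw [← sum_mul, sum_prod_eq_one hF1, one_mul]
          congr 1
          exact sum_congr rfl fun _ _ => by congr
      _ ≤ (if ∀ r, ∃ i, IsHandover (t ∘ ξ r) i then 1 else 0) + ∑ _r : Fin k, B := by
          refine add_le_add le_rfl ((probOf_exists_le hF0 _).trans (sum_le_sum fun r _ => ?_))
          rw [probOf_prod_eq hF1]
          exact probOf_pairInfo_empiricalLaw_le hn (K.law_nonneg _) (K.sum_law _) hδ0 hδ1 hδ
      _ = _ := by simp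
  have hlabels : ∑ t : Fin ℓ → Fin τ, ∏ i, PT (t i) = 1 := sum_prod_eq_one fun _ => hPT.2
  rw [← one_mul (_ + _), ← hlabels, sum_mul]
  refine sum_le_sum fun t _ => ?_
  by_cases ht : ∀ i, 0 < PT (t i)
  swap
  · push Not at ht
    obtain ⟨i, hi⟩ := ht
    have : ∏ i, PT (t i) = 0 := prod_eq_zero (mem_univ i) (le_antisymm hi (hPT.1 _))
    simp [this]
  refine mul_le_mul_of_nonneg_left ?_ (prod_nonneg fun i _ => (ht i).le)
  calc _ ≤ ∑ ξ : Fin k → Equiv.Perm (Fin ℓ), (1 / (Nat.factorial ℓ : ℝ)) ^ k *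
        ((if ∀ r, ∃ i, IsHandover (t ∘ ξ r) i then 1 else 0) + k * B) := by
        refine sum_le_sum fun ξ _ => mul_le_mul_of_nonneg_left ?_ (by positivity)
        convert hround t ht ξ
    _ = ∑ ξ : Fin k → Equiv.Perm (Fin ℓ), (1 / (Nat.factorial ℓ : ℝ)) ^ k *
        (if ∀ r, ∃ i, IsHandover (t ∘ ξ r) i then 1 else 0) + k * B := by
        simp only [mul_add, sum_add_distrib]
        congr 1
        rw [← sum_mul, sum_const, card_univ, Fintype.card_fun, Fintype.card_perm,
          Fintype.card_fin, Fintype.card_fin, nsmul_eq_mul, Nat.cast_pow, ← mul_pow]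
        rw [mul_one_div_cancel (by positivity), one_pow, one_mul]
    _ ≤ _ := by
        refine add_le_add ?_ le_rfl
        convert sum_ite_forall_isHandover_le hℓ t

theorem errorProb_mem_Icc {τ ℓ : ℕ} {W : Type*} [MeasurableSpace W] {pool : WorkerPool τ ℓ W}
    (hpool : pool.MeanIsMarkov) {PT : Fin τ → ℝ} (hPT : PT ∈ stdSimplex ℝ (Fin τ))
    (c₁ α : ℝ) (k n : ℕ) : pool.errorProb PT c₁ α k n ∈ Set.Icc (0 : ℝ) 1 := by
  classical
  obtain ⟨K, hK⟩ := hpool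
  have hmean : ∀ t, pool.meanLaw t = K.law t := fun t => funext (hK t)
  have h0 : ∀ (t : Fin ℓ → Fin τ) (ξ : Fin k → Equiv.Perm (Fin ℓ))
      (Y : Fin k → Fin n → Fin ℓ → Response τ),
      0 ≤ ∏ r, ∏ j, pool.meanLaw (t ∘ ξ r) (Y r j) := fun t ξ Y =>
    prod_nonneg fun r _ => prod_nonneg fun j _ => by rw [hmean]; exact K.law_nonneg _ _
  have hlabels : ∑ t : Fin ℓ → Fin τ, ∏ i, PT (t i) = 1 := sum_prod_eq_one fun _ => hPT.2
  unfold WorkerPool.errorProb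
  constructor
  · refine sum_nonneg fun t _ => mul_nonneg (prod_nonneg fun i _ => hPT.1 _) ?_
    refine sum_nonneg fun ξ _ => mul_nonneg (by positivity) ?_
    exact sum_nonneg fun Y _ => mul_nonneg (h0 t ξ Y) (by split_ifs <;> norm_num)
  · refine (sum_le_sum fun t _ =>
      mul_le_of_le_one_right (prod_nonneg fun i _ => hPT.1 _) ?_).trans_eq hlabels
    calc _ ≤ ∑ ξ : Fin k → Equiv.Perm (Fin ℓ), (1 / (Nat.factorial ℓ : ℝ)) ^ k * 1 := by
          refine sum_le_sum fun ξ _ => mul_le_mul_of_nonneg_left ?_ (by positivity)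
          have h1 : ∑ Y : Fin k → Fin n → Fin ℓ → Response τ,
              ∏ r, ∏ j, pool.meanLaw (t ∘ ξ r) (Y r j) = 1 := by
            simp only [hmean]
            exact sum_prod_eq_one fun r => sum_prod_eq_one fun _ => K.sum_law _
          refine le_of_le_of_eq ?_ h1
          exact sum_le_sum fun Y _ =>
            mul_le_of_le_one_right (h0 t ξ Y) (by split_ifs <;> norm_num)
      _ = 1 := by
          rw [mul_one, sum_const, card_univ, Fintype.card_fun, Fintype.card_perm,
            Fintype.card_fin, Fintype.card_fin, nsmul_eq_mul, Nat.cast_pow, ← mul_pow,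
            mul_one_div_cancel (by positivity), one_pow]

/-! ### Choice of the accuracy -/

/-- Cell probabilities that are accurate up to `δ = c n ^ (-α) / (1 + log n)`, for a small constant
`c`, give information values that are accurate up to half the threshold. -/
theorem exists_accuracy {M c₁ α : ℝ} (hc₁ : 0 < c₁) (hα₀ : 0 < α) (hα₁ : α ≤ 1) :
    ∃ c : ℝ, 0 < c ∧ ∀ n : ℕ, 0 < n → ∀ δ : ℝ, δ = c * (n : ℝ) ^ (-α) / (1 + Real.log n) →
      0 ≤ δ ∧ δ ≤ 1 ∧ M * (δ * (1 - Real.log δ)) ≤ threshold c₁ α n / 2 := by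
  have hlim : Tendsto (fun c : ℝ => |M| * (2 * c + Real.negMulLog c)) (𝓝[>] 0) (𝓝 0) := by
    have h : Continuous (fun c : ℝ => |M| * (2 * c + Real.negMulLog c)) :=
      continuous_const.mul ((continuous_const.mul continuous_id).add Real.continuous_negMulLog)
    have := (h.tendsto 0).mono_left (nhdsWithin_le_nhds (s := Set.Ioi 0))
    simpa using this
  have hev := (hlim.eventually_lt_const (half_pos hc₁)).and
    ((Ioc_mem_nhdsGT (zero_lt_one (α := ℝ))) : ∀ᶠ c in 𝓝[>] (0 : ℝ), c ∈ Set.Ioc (0 : ℝ) 1)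
  obtain ⟨c, hcM, hc0, hc1⟩ := hev.exists
  refine ⟨c, hc0, fun n hn δ hδ => ?_⟩
  have hn1 : (1 : ℝ) ≤ n := by exact_mod_cast hn
  have hn0 : (0 : ℝ) < n := by linarith
  have hlog : 0 ≤ Real.log n := Real.log_nonneg hn1
  have hpow : 0 < (n : ℝ) ^ (-α) := by positivity
  have hpow1 : (n : ℝ) ^ (-α) ≤ 1 := Real.rpow_le_one_of_one_le_of_nonpos hn1 (by linarith)
  have hδ0 : 0 < δ := by rw [hδ]; positivity
  have hδ1 : δ ≤ 1 := by
    rw [hδ, div_le_one (by positivity)]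
    nlinarith
  refine ⟨hδ0.le, hδ1, ?_⟩
  have hlogc : Real.log c ≤ 0 := Real.log_nonpos hc0.le hc1
  have hlogδ : -Real.log δ ≤ -Real.log c + 2 * Real.log n := by
    have h1 : Real.log (1 + Real.log n) ≤ Real.log n := by
      have := Real.log_le_sub_one_of_pos (show 0 < 1 + Real.log n by positivity)
      linarith
    rw [hδ, Real.log_div (by positivity) (by positivity), Real.log_mul hc0.ne' hpow.ne',
      Real.log_rpow hn0]
    nlinarith
  calc M * (δ * (1 - Real.log δ)) ≤ |M| * (δ * ((2 - Real.log c) * (1 + Real.log n))) := by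
        have hnn : 0 ≤ δ * (1 - Real.log δ) :=
          mul_nonneg hδ0.le (by linarith [Real.log_nonpos hδ0.le hδ1])
        refine (mul_le_mul_of_nonneg_right (le_abs_self M) hnn).trans
          (mul_le_mul_of_nonneg_left (mul_le_mul_of_nonneg_left ?_ hδ0.le) (abs_nonneg _))
        nlinarith
    _ = |M| * (2 * c + Real.negMulLog c) * (n : ℝ) ^ (-α) := by
        rw [hδ, Real.negMulLog]
        field_simp
        ring
    _ ≤ c₁ / 2 * (n : ℝ) ^ (-α) := mul_le_mul_of_nonneg_right hcM.le hpow.le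
    _ = threshold c₁ α n / 2 := by rw [threshold]; ring

/-- The error probability in terms of `n`, `k` and `ℓ`, with a constant `a` depending only on `τ`,
`α` and `c₁`. The exponent `n ^ (1 - 2 α) / (1 + log n) ^ 2` of the concentration inequality is
bounded below by a power `n ^ s`; different `s` serve for different ranges of the parameters. -/
theorem exists_errorProb_le (τ : ℕ) {α c₁ : ℝ} (hα₀ : 0 < α) (hα₁ : α ≤ 1) (hc₁ : 0 < c₁) :
    ∃ a : ℝ, 0 < a ∧ ∀ (ℓ : ℕ) (W : Type*) [MeasurableSpace W] (pool : WorkerPool τ ℓ W)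
      (PT : Fin τ → ℝ) (θ : ℝ) (k n : ℕ), 0 < ℓ → pool.MeanIsMarkov →
      PT ∈ stdSimplex ℝ (Fin τ) → (θ : EReal) ≤ pool.memoryQuality PT →
      threshold c₁ α n < θ → 0 < n → ∀ D s : ℝ,
      (1 + Real.log n) ^ 2 ≤ D * (n : ℝ) ^ (1 - 2 * α - s) →
      pool.errorProb PT c₁ α k n ≤ ((τ : ℝ) ^ 2 / ℓ) ^ k +
        k * ((ℓ : ℝ) ^ 2 * (2 * numCells τ * Real.exp (-(a / D * (n : ℝ) ^ s)))) := by
  obtain ⟨c, hc0, hc⟩ := exists_accuracy (M := numCells τ) hc₁ hα₀ hα₁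
  refine ⟨c ^ 2 / 4, by positivity, ?_⟩
  intro ℓ W _ pool PT θ k n hℓ hpool hPT hθ hγθ hn D s hD
  obtain ⟨hδ0, hδ1, hδ⟩ := hc n hn _ rfl
  refine (errorProb_le hpool hPT hℓ hθ hγθ hn hδ0 hδ1 hδ).trans ?_
  have hn1 : (1 : ℝ) ≤ n := by exact_mod_cast hn
  have hn0 : (0 : ℝ) < n := by linarith
  have hlog : 0 ≤ Real.log n := Real.log_nonneg hn1
  have hM := numCells_pos τ
  have hDpos : 0 < D := by
    have h1 : 0 < (1 + Real.log n) ^ 2 := by positivity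
    have h2 : 0 < (n : ℝ) ^ (1 - 2 * α - s) := by positivity
    exact pos_of_mul_pos_left (h1.trans_le hD) h2.le
  gcongr
  have e1 : (n : ℝ) * (c * (n : ℝ) ^ (-α) / (1 + Real.log n)) ^ 2 / 4 =
      c ^ 2 / 4 * ((n : ℝ) ^ (1 - 2 * α) / (1 + Real.log n) ^ 2) := by
    have : (n : ℝ) ^ (1 - 2 * α) = n * ((n : ℝ) ^ (-α)) ^ 2 := by
      rw [show 1 - 2 * α = 1 + -α * (2 : ℕ) by push_cast; ring, Real.rpow_add hn0, Real.rpow_one,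
        Real.rpow_mul hn0.le, Real.rpow_natCast]
    rw [this]; field_simp
  have e2 : (n : ℝ) ^ (1 - 2 * α) = (n : ℝ) ^ (1 - 2 * α - s) * (n : ℝ) ^ s := by
    rw [← Real.rpow_add hn0]; congr 1; ring
  rw [e1, div_mul_eq_mul_div, mul_div_assoc]
  refine mul_le_mul_of_nonneg_left ?_ (by positivity)
  rw [div_le_div_iff₀ hDpos (by positivity), e2]
  have hs : 0 < (n : ℝ) ^ s := by positivity
  nlinarith

theorem sq_one_add_log_le {x α : ℝ} (hx : 1 ≤ x) (hα : 0 < α) :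
    (1 + Real.log x) ^ 2 ≤ (2 + 1 / α) ^ 2 * x ^ (2 * α) := by
  have h0 : 0 ≤ Real.log x := Real.log_nonneg hx
  have h1 : Real.log x ≤ x ^ α / α := Real.log_le_rpow_div (by linarith) hα
  have h2 : 1 ≤ x ^ α := Real.one_le_rpow hx hα.le
  have h3 : 1 + Real.log x ≤ (2 + 1 / α) * x ^ α := by
    have : (2 + 1 / α) * x ^ α = 2 * x ^ α + x ^ α / α := by ring
    rw [this]; linarith
  have h4 : x ^ (2 * α) = (x ^ α) ^ 2 := by
    rw [← Real.rpow_natCast, ← Real.rpow_mul (by linarith)]; congr 1; push_cast; ring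
  rw [h4, ← mul_pow]
  exact pow_le_pow_left₀ (by positivity) h3 2

theorem sq_one_add_log_le_of_sq_logb_le {x β : ℝ} (hx : 1 ≤ x) (hβ : 0 ≤ β)
    (h : Real.logb 2 x ^ 2 ≤ x ^ β) : (1 + Real.log x) ^ 2 ≤ 4 * x ^ β := by
  have h0 : 0 ≤ Real.log x := Real.log_nonneg hx
  have h1 : Real.log x ≤ Real.logb 2 x := by
    rw [Real.logb, le_div_iff₀ (Real.log_pos (by norm_num))]
    nlinarith [Real.log_two_lt_d9]
  have h2 : 1 ≤ x ^ β := Real.one_le_rpow hx hβ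
  nlinarith [sq_nonneg (1 - Real.log x)]

/-! ### The number of rounds -/

/-- The number of rounds is at most a constant times `1 / ε`. -/
theorem ceil_rounds_le {τ ℓ : ℕ} (hτ : 0 < τ) (hℓ : τ ^ 2 < ℓ) {ε : ℝ} (hε0 : 0 < ε)
    (hε1 : ε ≤ 1) :
    max 1 (⌈-Real.log ε / (Real.log ℓ - 2 * Real.log τ)⌉₊ : ℝ) ≤
      (1 / |Real.log (τ ^ 2 + 1) - 2 * Real.log τ| + 1) / ε := by
  have hτ' : (0 : ℝ) < τ := by exact_mod_cast hτ
  have hℓ' : (τ : ℝ) ^ 2 + 1 ≤ ℓ := by exact_mod_cast hℓ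
  have h1 : 0 < Real.log (τ ^ 2 + 1) - 2 * Real.log τ := by
    have : Real.log ((τ : ℝ) ^ 2) < Real.log (τ ^ 2 + 1) :=
      Real.log_lt_log (by positivity) (by linarith)
    rw [Real.log_pow] at this
    push_cast at this
    linarith
  have h2 : Real.log (τ ^ 2 + 1) - 2 * Real.log τ ≤ Real.log ℓ - 2 * Real.log τ :=
    sub_le_sub_right (Real.log_le_log (by positivity) hℓ') _
  have h3 : 0 ≤ -Real.log ε := by linarith [Real.log_nonpos hε0.le hε1]
  have h4 : -Real.log ε ≤ 1 / ε := by
    have := Real.log_le_sub_one_of_pos (one_div_pos.2 hε0)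
    rw [one_div, Real.log_inv] at this
    rw [one_div]; linarith
  have h5 : 1 ≤ 1 / ε := by rw [le_div_iff₀ hε0]; linarith
  rw [abs_of_pos h1, add_div]
  have h6 : 0 ≤ 1 / (Real.log (τ ^ 2 + 1) - 2 * Real.log τ) / ε := by positivity
  refine max_le (by linarith) ?_
  refine (Nat.ceil_lt_add_one (div_nonneg h3 (h1.le.trans h2))).le.trans (add_le_add ?_ h5)
  calc _ ≤ (1 / ε) / (Real.log (τ ^ 2 + 1) - 2 * Real.log τ) :=
        div_le_div₀ (by positivity) h4 h1 h2
    _ = _ := by rw [div_right_comm]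

theorem pow_rounds_le {τ ℓ : ℕ} (hτ : 0 < τ) (hℓ : τ ^ 2 < ℓ) {ε : ℝ} (hε0 : 0 < ε) {k : ℕ}
    (hk : ⌈-Real.log ε / (Real.log ℓ - 2 * Real.log τ)⌉₊ ≤ k) :
    ((τ : ℝ) ^ 2 / ℓ) ^ k ≤ ε := by
  have hτ' : (0 : ℝ) < τ := by exact_mod_cast hτ
  have hℓ' : (τ : ℝ) ^ 2 < ℓ := by exact_mod_cast hℓ
  have hℓ0 : (0 : ℝ) < ℓ := lt_trans (by positivity) hℓ'
  have h1 : Real.log (τ ^ 2 / ℓ : ℝ) = -(Real.log ℓ - 2 * Real.log τ) := by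
    rw [Real.log_div (by positivity) hℓ0.ne', Real.log_pow]; push_cast; ring
  have h2 : 0 < Real.log ℓ - 2 * Real.log τ := by
    have : Real.log (τ ^ 2 / ℓ : ℝ) < 0 :=
      Real.log_neg (by positivity) (by rwa [div_lt_one hℓ0])
    linarith
  have h3 := Nat.ceil_le.1 hk
  rw [div_le_iff₀ h2] at h3
  rw [← Real.log_le_log_iff (by positivity) hε0, Real.log_pow, h1]
  linarith

theorem pos_of_mem_stdSimplex {τ : ℕ} {PT : Fin τ → ℝ} (h : PT ∈ stdSimplex ℝ (Fin τ)) :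
    0 < τ := by
  rcases Nat.eq_zero_or_pos τ with rfl | h0
  · have := h.2
    simp at this
  · exact h0

/-! ### Sample complexity and consistency -/

/-- The union bound over `k` rounds and `ℓ ^ 2` pairs is at most `ε` when the exponent of the
concentration inequality is a large multiple of `log ℓ - log ε`. -/
theorem rounds_mul_exp_le {ℓ : ℝ} {ε k B N E : ℝ} (hℓ : 2 ≤ ℓ) (hε0 : 0 < ε) (hε1 : ε ≤ 1 / 2)
    (hB : 0 ≤ B) (hN : 0 ≤ N) (hk : k ≤ B / ε)
    (hE : (2 + B * N) * (Real.log ℓ - Real.log ε) ≤ E) :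
    k * (ℓ ^ 2 * (N * Real.exp (-E))) ≤ ε := by
  have hℓ0 : 0 < ℓ := by linarith
  have hL : 1 ≤ Real.log ℓ - Real.log ε := by
    have h1 : Real.log 2 ≤ Real.log ℓ := Real.log_le_log (by norm_num) hℓ
    have h2 : Real.log ε ≤ Real.log (1 / 2) := Real.log_le_log hε0 hε1
    rw [one_div, Real.log_inv] at h2
    linarith [Real.log_two_gt_d9]
  have hBN : 0 ≤ B * N := mul_nonneg hB hN
  have h1 : Real.exp (-E) ≤ (ε / ℓ) ^ 2 * Real.exp (-(B * N)) := by
    have : (ε / ℓ) ^ 2 = Real.exp (-(2 * (Real.log ℓ - Real.log ε))) := by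
      rw [← Real.exp_log (div_pos hε0 hℓ0), ← Real.exp_nat_mul,
        Real.log_div hε0.ne' hℓ0.ne']
      congr 1; push_cast; ring
    rw [this, ← Real.exp_add, Real.exp_le_exp]
    nlinarith
  have h2 : B * N * Real.exp (-(B * N)) ≤ 1 := by
    rw [Real.exp_neg, ← div_eq_mul_inv, div_le_one (Real.exp_pos _)]
    linarith [Real.add_one_le_exp (B * N)]
  calc k * (ℓ ^ 2 * (N * Real.exp (-E)))
      ≤ B / ε * (ℓ ^ 2 * (N * ((ε / ℓ) ^ 2 * Real.exp (-(B * N))))) := by gcongr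
    _ = ε * (B * N * Real.exp (-(B * N))) := by field_simp
    _ ≤ ε * 1 := mul_le_mul_of_nonneg_left h2 hε0.le
    _ = ε := mul_one ε

/-- The constant of the sample complexity: `C ^ s ≥ R` for those of two exponents `s` that are
positive, and `c₁ C ^ (-α) < 1`, which keeps the threshold below the memory quality. -/
theorem exists_sample_constant {α c₁ : ℝ} (hα : 0 < α) (s₁ s₂ R : ℝ) :
    ∃ C : ℝ, 0 < C ∧ c₁ * C ^ (-α) < 1 ∧ (0 < s₁ → R ≤ C ^ s₁) ∧ (0 < s₂ → R ≤ C ^ s₂) := by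
  have h1 : ∀ s : ℝ, ∀ᶠ C : ℝ in atTop, 0 < s → R ≤ C ^ s := by
    intro s
    by_cases hs : 0 < s
    · filter_upwards [(tendsto_rpow_atTop hs).eventually_ge_atTop R] with C hC _ using hC
    · exact Eventually.of_forall fun C h => absurd h hs
  have h2 : ∀ᶠ C : ℝ in atTop, c₁ * C ^ (-α) < 1 := by
    have := (tendsto_rpow_neg_atTop hα).const_mul c₁
    rw [mul_zero] at this
    exact this.eventually_lt_const zero_lt_one
  obtain ⟨C, h⟩ := ((eventually_gt_atTop 0).and (h2.and ((h1 s₁).and (h1 s₂)))).exists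
  exact ⟨C, h⟩

theorem threshold_lt {α c₁ C θ : ℝ} {n : ℕ} (hα : 0 < α) (hc₁ : 0 < c₁) (hC : 0 < C)
    (hCα : c₁ * C ^ (-α) < 1) (hθ : 0 < θ) (hn : C * θ ^ (-1 / α) ≤ n) :
    threshold c₁ α n < θ := by
  have h1 : 0 < C * θ ^ (-1 / α) := by positivity
  have h2 : (n : ℝ) ^ (-α) ≤ C ^ (-α) * θ := by
    calc (n : ℝ) ^ (-α) ≤ (C * θ ^ (-1 / α)) ^ (-α) :=
          Real.rpow_le_rpow_of_nonpos h1 hn (by linarith)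
      _ = C ^ (-α) * θ := by
          rw [Real.mul_rpow hC.le (by positivity), ← Real.rpow_mul hθ.le,
            show -1 / α * -α = 1 by field_simp, Real.rpow_one]
  calc threshold c₁ α n ≤ c₁ * (C ^ (-α) * θ) := mul_le_mul_of_nonneg_left h2 hc₁.le
    _ = c₁ * C ^ (-α) * θ := by ring
    _ < 1 * θ := mul_lt_mul_of_pos_right hCα hθ
    _ = θ := one_mul θ

theorem mul_le_rpow_of_mul_rpow_le {C L s x R : ℝ} (hC : 0 < C) (hL : 0 ≤ L) (hs : 0 < s)
    (hR : R ≤ C ^ s) (h : C * L ^ (1 / s) ≤ x) : R * L ≤ x ^ s := by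
  calc R * L ≤ C ^ s * L := mul_le_mul_of_nonneg_right hR hL
    _ = (C * L ^ (1 / s)) ^ s := by
        rw [Real.mul_rpow hC.le (by positivity), ← Real.rpow_mul hL, one_div_mul_cancel hs.ne',
          Real.rpow_one]
    _ ≤ x ^ s := Real.rpow_le_rpow (by positivity) h hs.le

theorem tendsto_pow_mul_exp_neg_mul_rpow {b s : ℝ} (hb : 0 < b) (hs : 0 < s) (d : ℕ) :
    Tendsto (fun n : ℕ => (n : ℝ) ^ d * Real.exp (-(b * (n : ℝ) ^ s))) atTop (𝓝 0) := by
  have h1 : Tendsto (fun n : ℕ => (n : ℝ) ^ s) atTop atTop :=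
    (tendsto_rpow_atTop hs).comp tendsto_natCast_atTop_atTop
  have h2 := (tendsto_rpow_mul_exp_neg_mul_atTop_nhds_zero (d / s) b hb).comp h1
  refine h2.congr fun n => ?_
  simp only [Function.comp]
  rw [← Real.rpow_mul (Nat.cast_nonneg n), mul_div_cancel₀ _ hs.ne', Real.rpow_natCast, neg_mul]

theorem mainTheorem6 (τ : ℕ) (α c₁ : ℝ) (hα₀ : 0 < α) (hα₁ : α < 1 / 2) (hc₁ : 0 < c₁) :
    (∀ β : ℝ, 0 < β → β < 1 → (2 * α + β < 1 ∨ 4 * α < 1) → ∀ κ : ℕ, ∃ C : ℝ, 0 < C ∧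
      ∀ (ℓ : ℕ) (W : Type*) [MeasurableSpace W] (pool : WorkerPool τ ℓ W) (PT : Fin τ → ℝ)
        (ε θ : ℝ) (k n : ℕ),
        τ ^ 2 < ℓ → pool.MeanIsMarkov → PT ∈ stdSimplex ℝ (Fin τ) → 0 < ε →
        0 < θ → (θ : EReal) ≤ pool.memoryQuality PT →
        ⌈-Real.log ε / (Real.log ℓ - 2 * Real.log τ)⌉₊ ≤ k →
        k ≤ κ * max 1 ⌈-Real.log ε / (Real.log ℓ - 2 * Real.log τ)⌉₊ →
        Real.logb 2 n ^ 2 ≤ (n : ℝ) ^ β →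
        C * max (max ((Real.log ℓ - Real.log ε) ^ (1 / (1 - 2 * α - β)))
          ((Real.log ℓ - Real.log ε) ^ (1 / (1 - 4 * α)))) (θ ^ (-1 / α)) ≤ (n : ℝ) →
        pool.errorProb PT c₁ α k n ≤ 2 * ε) ∧
    (∀ (ℓ : ℕ) (W : Type*) [MeasurableSpace W] (pool : WorkerPool τ ℓ W) (PT : Fin τ → ℝ),
      τ ^ 2 < ℓ → pool.MeanIsMarkov → PT ∈ stdSimplex ℝ (Fin τ) →
      0 < pool.memoryQuality PT →
      ∀ k : ℕ → ℕ, Tendsto k atTop atTop →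
        (∃ d : ℕ, (fun n => (k n : ℝ)) =O[atTop] (fun n : ℕ => (n : ℝ) ^ d)) →
        Tendsto (fun n => pool.errorProb PT c₁ α (k n) n) atTop (𝓝 0)) := by
  constructor
  · intro β hβ0 hβ1 hαβ κ
    obtain ⟨a, ha, herr⟩ := exists_errorProb_le τ hα₀ (by linarith) hc₁
    have hM := numCells_pos τ
    set B : ℝ := κ * (1 / |Real.log (τ ^ 2 + 1) - 2 * Real.log τ| + 1) with hB
    have hB0 : 0 ≤ B := by positivity
    set D : ℝ := (2 + 1 / α) ^ 2 with hD
    have hD0 : 0 < D := by positivity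
    have hD4 : 4 ≤ D := by
      have : 0 < 1 / α := by positivity
      nlinarith
    obtain ⟨C, hC0, hCα, hC1, hC2⟩ := exists_sample_constant (c₁ := c₁) hα₀ (1 - 2 * α - β)
      (1 - 4 * α) (D / a * (2 + B * (2 * numCells τ)))
    refine ⟨C, hC0, ?_⟩
    intro ℓ W _ pool PT ε θ k n hℓ hpool hPT hε0 hθ0 hθ hk1 hk2 hnβ hn
    rcases lt_or_ge (1 / 2) ε with hε | hε
    · exact (errorProb_mem_Icc hpool hPT c₁ α k n).2.trans (by linarith)
    have hτ := pos_of_mem_stdSimplex hPT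
    have hℓ2 : 2 ≤ ℓ := by nlinarith
    have hℓ2' : (2 : ℝ) ≤ ℓ := by exact_mod_cast hℓ2
    have hn1 := (mul_le_mul_of_nonneg_left ((le_max_left _ _).trans (le_max_left _ _))
      hC0.le).trans hn
    have hn2 := (mul_le_mul_of_nonneg_left ((le_max_right _ _).trans (le_max_left _ _))
      hC0.le).trans hn
    have hn3 := (mul_le_mul_of_nonneg_left (le_max_right _ _) hC0.le).trans hn
    have hγθ := threshold_lt hα₀ hc₁ hC0 hCα hθ0 hn3
    have hnpos : 0 < n := by
      have h : 0 < C * θ ^ (-1 / α) := by positivity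
      exact_mod_cast h.trans_le hn3
    have hn1' : (1 : ℝ) ≤ n := by exact_mod_cast hnpos
    have hkB : (k : ℝ) ≤ B / ε := by
      have h1 := ceil_rounds_le hτ hℓ hε0 (by linarith : ε ≤ 1)
      have h2 : (k : ℝ) ≤ κ * max 1 (⌈-Real.log ε / (Real.log ℓ - 2 * Real.log τ)⌉₊ : ℝ) := by
        exact_mod_cast hk2
      rw [hB, mul_div_assoc]
      exact h2.trans (mul_le_mul_of_nonneg_left h1 (Nat.cast_nonneg κ))
    have hL0 : 0 ≤ Real.log ℓ - Real.log ε := by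
      have := Real.log_nonneg (by linarith : (1 : ℝ) ≤ ℓ)
      have := Real.log_nonpos hε0.le (by linarith)
      linarith
    -- it suffices to use the exponent `s` that is positive
    have key : ∀ s : ℝ, 0 < s → D / a * (2 + B * (2 * numCells τ)) ≤ C ^ s →
        C * (Real.log ℓ - Real.log ε) ^ (1 / s) ≤ n →
        (1 + Real.log n) ^ 2 ≤ D * (n : ℝ) ^ (1 - 2 * α - s) →
        pool.errorProb PT c₁ α k n ≤ 2 * ε := by
      intro s hs hCs hns hlog
      refine (herr ℓ W pool PT θ k n (by omega) hpool hPT hθ hγθ hnpos D s hlog).trans ?_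
      rw [two_mul ε]
      refine add_le_add (pow_rounds_le hτ hℓ hε0 hk1) ?_
      refine rounds_mul_exp_le hℓ2' hε0 hε hB0 (by positivity) hkB ?_
      have h1 := mul_le_rpow_of_mul_rpow_le hC0 hL0 hs hCs hns
      have h2 := mul_le_mul_of_nonneg_left h1 (div_pos ha hD0).le
      refine le_trans (le_of_eq ?_) h2
      field_simp
    rcases hαβ with h | h
    · refine key (1 - 2 * α - β) (by linarith) (hC1 (by linarith)) hn1 ?_
      rw [show 1 - 2 * α - (1 - 2 * α - β) = β by ring]
      exact (sq_one_add_log_le_of_sq_logb_le hn1' hβ0.le hnβ).trans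
        (mul_le_mul_of_nonneg_right hD4 (by positivity))
    · refine key (1 - 4 * α) (by linarith) (hC2 (by linarith)) hn2 ?_
      rw [show 1 - 2 * α - (1 - 4 * α) = 2 * α by ring]
      exact sq_one_add_log_le hn1' hα₀
  · intro ℓ W _ pool PT hℓ hpool hPT hquality k hk ⟨d, hkd⟩
    obtain ⟨a, ha, herr⟩ := exists_errorProb_le τ hα₀ (by linarith) hc₁
    obtain ⟨θ, hθ0, hθ⟩ := EReal.lt_iff_exists_real_btwn.1 hquality
    have hθ0 : 0 < θ := by exact_mod_cast hθ0
    have hℓ0 : 0 < ℓ := by omega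
    have hℓ' : (τ : ℝ) ^ 2 < ℓ := by exact_mod_cast hℓ
    set s : ℝ := (1 - 2 * α) / 2 with hs
    have hs0 : 0 < s := by rw [hs]; linarith
    set D : ℝ := (2 + 1 / (s / 2)) ^ 2 with hD
    have hD0 : 0 < D := by positivity
    have hthr : ∀ᶠ n : ℕ in atTop, threshold c₁ α n < θ := by
      have := ((tendsto_rpow_neg_atTop hα₀).const_mul c₁).comp tendsto_natCast_atTop_atTop
      rw [mul_zero] at this
      exact this.eventually_lt_const hθ0
    have hbound : ∀ᶠ n : ℕ in atTop, pool.errorProb PT c₁ α (k n) n ≤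
        ((τ : ℝ) ^ 2 / ℓ) ^ (k n) + (k n : ℝ) *
          ((ℓ : ℝ) ^ 2 * (2 * numCells τ * Real.exp (-(a / D * (n : ℝ) ^ s)))) := by
      filter_upwards [hthr, eventually_gt_atTop 0] with n hn hn0
      refine herr ℓ W pool PT θ (k n) n hℓ0 hpool hPT hθ.le hn hn0 D s ?_
      have hn1 : (1 : ℝ) ≤ n := by exact_mod_cast hn0
      have := sq_one_add_log_le hn1 (half_pos hs0)
      rwa [show 2 * (s / 2) = 1 - 2 * α - s by rw [hs]; ring] at this
    have hlim1 : Tendsto (fun n => ((τ : ℝ) ^ 2 / ℓ) ^ (k n)) atTop (𝓝 0) :=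
      (tendsto_pow_atTop_nhds_zero_of_lt_one (by positivity)
        ((div_lt_one (by exact_mod_cast hℓ0)).2 hℓ')).comp hk
    have hlim2 : Tendsto (fun n : ℕ => (k n : ℝ) *
        ((ℓ : ℝ) ^ 2 * (2 * numCells τ * Real.exp (-(a / D * (n : ℝ) ^ s))))) atTop (𝓝 0) := by
      have h1 : Tendsto (fun n : ℕ => (k n : ℝ) * Real.exp (-(a / D * (n : ℝ) ^ s))) atTop (𝓝 0) :=
        (hkd.mul (Asymptotics.isBigO_refl _ _)).trans_tendsto
          (tendsto_pow_mul_exp_neg_mul_rpow (div_pos ha hD0) hs0 d)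
      have h2 := h1.const_mul ((ℓ : ℝ) ^ 2 * (2 * numCells τ))
      rw [mul_zero] at h2
      exact h2.congr fun n => by ring
    have hlim := hlim1.add hlim2
    rw [add_zero] at hlim
    exact tendsto_of_tendsto_of_tendsto_of_le_of_le' tendsto_const_nhds hlim
      (Eventually.of_forall fun n => (errorProb_mem_Icc hpool hPT c₁ α (k n) n).1) hbound
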